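/- Let $\omega_0,\epsilon_F>0$ be fixed. Put $f_0(x)=1/(e^x+1)$, $n_0(x)=1/(e^x-1)$, and for $T>0$ $$w(\epsilon)=f_0(\epsilon/T)\,[1-f_0(\epsilon/T)],\qquad \bar k_0(x,y)=[n_0(y)+f_0(x+y)]\,y^2\,\mathrm{sgn}(y),$$ $$\bar K_0(\epsilon,u)=\Big(\frac{T}{\omega_0}\Big)^2\bar k_0\Big(\frac{\epsilon}{T},\frac{u-\epsilon}{T}\Big),\quad \bar K_1(\epsilon,u)=\frac{u-\epsilon}{2\epsilon_F}\,\bar K_0(\epsilon,u),\quad \bar K_2(\epsilon,u)=\frac12\Big(\frac{u-\epsilon}{\omega_0}\Big)^2\bar K_0(\epsilon,u),$$ $\Gamma_\nu(\epsilon)=\int_{\mathbb R}\bar K_\nu(\epsilon,u)\,du$ and $K_\nu(\epsilon,u)=\bar K_\nu(\epsilon,u)/\Gamma_0(\epsilon)$ for $\nu=0,1,2$, and $K=K_0+K_1-K_2$. Let $d\sigma=w\,\Gamma_0\,d\epsilon$. Write $K_0$ also for the integral operator $(K_0g)(\epsilon)=\int_{\mathbb R}K_0(\epsilon,u)g(u)\,du$,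 and $\langle g\rangle_w=\int_{\mathbb R} g\,w\,d\epsilon\big/\int_{\mathbb R} w\,d\epsilon$. **Theorem.** (a) For every $T>0$ all integrals in these definitions and in the expression below converge, $\Gamma_0>0$, the series converges, and the rate $$\frac1{\phi_+(T)}=\langle\Gamma_2\rangle_w+\sum_{m=0}^\infty\big\langle\Gamma_1\,(K_0)^m(\Gamma_1/\Gamma_0)\big\rangle_w$$ is positive. (b) There is $T_0>0$ such that for $0<T<T_0$ the electron–phonon Boltzmann integral equation $$\varphi(\epsilon)=\frac1{\Gamma_0(\epsilon)}+\int_{\mathbb R}K(\epsilon,u)\,\varphi(u)\,du\qquad\text{for a.e. }\epsilon\in\mathbb R$$ has a solution $\varphi=\varphi_T\in L^2(\mathbb R,d\sigma)$, unique up to equality almost everywhere, and $w\varphi_T$ is integrable. The transport relaxation time $\tau(T)=\frac1{2T}\int_{\mathbb R}w(\epsilon)\,\varphi_T(\epsilon)\,d\epsilon$ is thus well defined. (c) There is a constant $C>0$, depending only on $\omega_0$ and $\epsilon_F$, such that $\phi_+(T)=C\,T^{-5}$ for all $T>0$; and, as $T\to0^+$, $\tau(T)\sim\phi_+(T)/2$,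 that is, $\tau(T)/(\phi_+(T)/2)\to1$. In particular Bloch's law holds: $T^5\,\tau(T)\to C/2$. -/

import Mathlib

open MeasureTheory Filter Topology Asymptotics

noncomputable section

namespace Bloch

/-- Fermi distribution function. -/
def f₀ (x : ℝ) : ℝ := 1 / (Real.exp x + 1)

/-- Bose distribution function. -/
def n₀ (x : ℝ) : ℝ := 1 / (Real.exp x - 1)

/-- Weight function `w(ε) = f₀(ε/T) (1 - f₀(ε/T))` at temperature `T`. -/
def w (T ε : ℝ) : ℝ := f₀ (ε / T) * (1 - f₀ (ε / T))

/-- Dimensionless basic kernel `k̄₀(x,y) = [n₀(y) + f₀(y+x)] y² sgn y`. -/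
def kbar₀ (x y : ℝ) : ℝ := (n₀ y + f₀ (y + x)) * y ^ 2 * Real.sign y

/-- `K̄₀(ε,u) = (T/ω₀)² k̄₀(ε/T, (u-ε)/T)`. -/
def Kbar₀ (ω₀ T ε u : ℝ) : ℝ := (T / ω₀) ^ 2 * kbar₀ (ε / T) ((u - ε) / T)

/-- `K̄₁(ε,u) = (ω₀/2ε_F) (T/ω₀) ((u-ε)/T) K̄₀(ε,u)`. -/
def Kbar₁ (ω₀ εF T ε u : ℝ) : ℝ :=
  ω₀ / (2 * εF) * (T / ω₀) * ((u - ε) / T) * Kbar₀ ω₀ T ε u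

/-- `K̄₂(ε,u) = ½ (T/ω₀)² ((u-ε)/T)² K̄₀(ε,u)`. -/
def Kbar₂ (ω₀ T ε u : ℝ) : ℝ :=
  1 / 2 * (T / ω₀) ^ 2 * ((u - ε) / T) ^ 2 * Kbar₀ ω₀ T ε u

/-- Single-particle relaxation rate `Γ₀(ε) = ∫ K̄₀(ε,u) du`. -/
def Γ₀ (ω₀ T ε : ℝ) : ℝ := ∫ u, Kbar₀ ω₀ T ε u

/-- `Γ₁(ε) = ∫ K̄₁(ε,u) du`. -/
def Γ₁ (ω₀ εF T ε : ℝ) : ℝ := ∫ u, Kbar₁ ω₀ εF T ε u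

/-- `Γ₂(ε) = ∫ K̄₂(ε,u) du`. -/
def Γ₂ (ω₀ T ε : ℝ) : ℝ := ∫ u, Kbar₂ ω₀ T ε u

/-- `K₀(ε,u) = K̄₀(ε,u) / Γ₀(ε)`. -/
def K₀ (ω₀ T ε u : ℝ) : ℝ := Kbar₀ ω₀ T ε u / Γ₀ ω₀ T ε

/-- `K₁(ε,u) = K̄₁(ε,u) / Γ₀(ε)`. -/
def K₁ (ω₀ εF T ε u : ℝ) : ℝ := Kbar₁ ω₀ εF T ε u / Γ₀ ω₀ T ε

/-- `K₂(ε,u) = K̄₂(ε,u) / Γ₀(ε)`. -/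
def K₂ (ω₀ T ε u : ℝ) : ℝ := Kbar₂ ω₀ T ε u / Γ₀ ω₀ T ε

/-- Full kernel `K = K₀ + K₁ - K₂`. -/
def K (ω₀ εF T ε u : ℝ) : ℝ := K₀ ω₀ T ε u + K₁ ω₀ εF T ε u - K₂ ω₀ T ε u

/-- The measure `dσ(ε) = w(ε) Γ₀(ε) dε`. -/
def sigmaMeasure (ω₀ T : ℝ) : Measure ℝ :=
  volume.withDensity fun ε => ENNReal.ofReal (w T ε * Γ₀ ω₀ T ε)

/-- `φ` is a solution in `L²(σ)` of the integral equation
`φ(ε) = 1/Γ₀(ε) + ∫ K(ε,u) φ(u) du`. -/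
structure IsSolution (ω₀ εF T : ℝ) (φ : ℝ → ℝ) : Prop where
  memLp : MemLp φ 2 (sigmaMeasure ω₀ T)
  eqn : ∀ᵐ ε, Integrable (fun u => K ω₀ εF T ε u * φ u) ∧
    φ ε = 1 / Γ₀ ω₀ T ε + ∫ u, K ω₀ εF T ε u * φ u

/-- Transport relaxation time `(1/2T) ∫ w(ε) φ(ε) dε` belonging to an inverse rate `φ`. -/
def relaxationTime (T : ℝ) (φ : ℝ → ℝ) : ℝ := 1 / (2 * T) * ∫ ε, w T ε * φ ε

/-- Average `⟨g⟩_w = ∫ g w dε / ∫ w dε`. -/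
def avg (T : ℝ) (g : ℝ → ℝ) : ℝ := (∫ ε, g ε * w T ε) / ∫ ε, w T ε

/-- The integral operator with kernel `K₀`. -/
def K₀op (ω₀ T : ℝ) (g : ℝ → ℝ) : ℝ → ℝ := fun ε => ∫ u, K₀ ω₀ T ε u * g u

/-- The function `(K₀)^m (Γ₁/Γ₀)`. -/
def iter (ω₀ εF T : ℝ) (m : ℕ) : ℝ → ℝ :=
  (K₀op ω₀ T)^[m] fun ε => Γ₁ ω₀ εF T ε / Γ₀ ω₀ T ε

/-- The function `Γ₁ (K₀)^m (Γ₁/Γ₀)`. -/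
def term (ω₀ εF T : ℝ) (m : ℕ) : ℝ → ℝ := fun ε => Γ₁ ω₀ εF T ε * iter ω₀ εF T m ε

/-- The rate `1/φ₊ = ⟨Γ₂⟩_w + ∑ₘ ⟨Γ₁ (K₀)^m Γ₁/Γ₀⟩_w`. -/
def rate (ω₀ εF T : ℝ) : ℝ :=
  avg T (Γ₂ ω₀ T) + ∑' m : ℕ, avg T (term ω₀ εF T m)

/-- `φ₊`. -/
def phiPlus (ω₀ εF T : ℝ) : ℝ := 1 / rate ω₀ εF T

end Bloch

end

/-! In the variable `x = ε / T` the basic kernel factors as `hker (y - x) * ch x / ch y` with `hker`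
even, and `w = 1 / (4 ch²)`: this is detailed balance. Conjugating by `evec`, the square root of the
dimensionless density of `σ`, turns the three integral operators into bounded operators `Mop i` on
`L²(dx)` with kernels `(y - x) ^ i * hker (y - x) / (sγ x * sγ y)`. Hence `Mop 0` and `Mop 2` are
symmetric and `Mop 1` is skew. Particle conservation becomes `Mop 0 eL = eL`, and the Boltzmann
equation becomes `(1 - M₀ - T M₁ + T² M₂) F = b`, a perturbation problem in which `T` is the only
small parameter and `M₁`, `M₂` absorb the constants.

The analytic core is the gap of `M₀` on the complement of `e` (`exists_spectral_gap`). The deficit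
`‖F‖² - ‖M₀ F‖²` is the integrated variance of a Markov chain. On a bounded interval a Doeblin
minorization bounds it from below; outside a large interval `M₀` is small because the rate `γ₀`
grows like a cube.

Given the gap, `energy` yields coercivity of order `T²`, hence unique solvability by Lax–Milgram.
Write `F = α e + ψ` with `ψ ⊥ e`, and let `v` solve `v - M₀ v = M₁ e`. Pairing the equation with the
approximate null vector `e - T v` of the adjoint gives `T² α → 1/κ`, where `κ = ⟪e, M₂ e⟫ + ⟪M₁ e,
v⟫`. The Neumann series for `v` is the series in the definition of `rate`, so `rate = T⁵ κ / ω₀²`,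
while `τ = ω₀² / (2 T³) * ⟪b, F⟫`; both Bloch's law and `τ ∼ φ₊ / 2` follow. -/

open scoped RealInnerProductSpace

/-! ### Singular perturbation of a gapped symmetric operator in Hilbert space -/

section Abstract

variable {H : Type*} [NormedAddCommGroup H] [InnerProductSpace ℝ H]

/-- A symmetric operator `M₀` fixing `e` and contracting the orthogonal complement of `e`, together
with a skew operator `M₁` and a symmetric operator `M₂` that is positive in the direction `e`. -/
structure GappedTriple (M₀ M₁ M₂ : H →L[ℝ] H) (e : H) (q : ℝ) : Prop where
  symm₀ : ∀ x y, ⟪M₀ x, y⟫ = ⟪x, M₀ y⟫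
  skew₁ : ∀ x y, ⟪M₁ x, y⟫ = -⟪x, M₁ y⟫
  symm₂ : ∀ x y, ⟪M₂ x, y⟫ = ⟪x, M₂ y⟫
  fix : M₀ e = e
  ne_zero : e ≠ 0
  nonneg : 0 ≤ q
  lt_one : q < 1
  gap : ∀ x, ⟪e, x⟫ = 0 → ‖M₀ x‖ ≤ q * ‖x‖
  pos : 0 < ⟪e, M₂ e⟫

/-- The perturbed operator `1 - M₀ - t M₁ + t² M₂`. -/
noncomputable def perturbedOp (M₀ M₁ M₂ : H →L[ℝ] H) (t : ℝ) : H →L[ℝ] H :=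
  ContinuousLinearMap.id ℝ H - M₀ - t • M₁ + t ^ 2 • M₂

lemma perturbedOp_apply (M₀ M₁ M₂ : H →L[ℝ] H) (t : ℝ) (x : H) :
    perturbedOp M₀ M₁ M₂ t x = x - M₀ x - t • M₁ x + t ^ 2 • M₂ x := by
  simp [perturbedOp]

namespace GappedTriple

variable {M₀ M₁ M₂ : H →L[ℝ] H} {e : H} {q : ℝ}

lemma inner_skew_self (h : GappedTriple M₀ M₁ M₂ e q) (x : H) : ⟪M₁ x, x⟫ = 0 := by
  have := h.skew₁ x x
  rw [real_inner_comm (M₁ x) x] at this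
  linarith

lemma inner_skew_fixed (h : GappedTriple M₀ M₁ M₂ e q) : ⟪e, M₁ e⟫ = 0 := by
  rw [real_inner_comm]; exact h.inner_skew_self e

lemma gap_inner (h : GappedTriple M₀ M₁ M₂ e q) {x : H} (hx : ⟪e, x⟫ = 0) :
    (1 - q) * ‖x‖ ^ 2 ≤ ⟪x - M₀ x, x⟫ := by
  have h1 := real_inner_le_norm (M₀ x) x
  have h2 := h.gap x hx
  rw [inner_sub_left, real_inner_self_eq_norm_sq]
  nlinarith [norm_nonneg x]

/-- Energy estimate for the perturbed operator. -/
lemma energy (h : GappedTriple M₀ M₁ M₂ e q) :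
    ∃ t₀ > 0, ∃ c > 0, ∀ t : ℝ, 0 < t → t < t₀ → ∀ (α : ℝ) (ψ : H), ⟪e, ψ⟫ = 0 →
      c * (‖ψ‖ ^ 2 + t ^ 2 * α ^ 2) ≤
        ⟪perturbedOp M₀ M₁ M₂ t (α • e + ψ), α • e + ψ⟫ := by
  set β := ⟪e, M₂ e⟫ with hβ
  have hβ0 : 0 < β := h.pos
  set m := ‖M₂‖
  set n := ‖e‖
  have hm : 0 ≤ m := norm_nonneg _
  have hq : 0 < 1 - q := by linarith [h.lt_one]
  -- `D` is the price in `‖ψ‖²` of absorbing the cross term `2 α ⟪M₂ e, ψ⟫` into half of `α² β` by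
  -- completing the square. The bound on `t` makes `t² D` at most half of the gap.
  set D := 2 * (m * n) ^ 2 / β + m with hD
  have hD0 : 0 ≤ D := by positivity
  refine ⟨min 1 ((1 - q) / (2 * (D + 1))), by positivity, min ((1 - q) / 2) (β / 2),
    by positivity, fun t ht ht0 α ψ hψ => ?_⟩
  have ht1 : t < 1 := ht0.trans_le (min_le_left _ _)
  have ht2 : t < (1 - q) / (2 * (D + 1)) := ht0.trans_le (min_le_right _ _)
  have htD : t ^ 2 * D ≤ (1 - q) / 2 := by
    rw [lt_div_iff₀ (by positivity)] at ht2
    nlinarith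
  have hfix : (α • e + ψ) - M₀ (α • e + ψ) = ψ - M₀ ψ := by
    rw [map_add, map_smul, h.fix]; abel
  have horth : ⟪ψ - M₀ ψ, e⟫ = 0 := by
    rw [inner_sub_left, h.symm₀, h.fix, sub_self]
  have hexp : ⟪perturbedOp M₀ M₁ M₂ t (α • e + ψ), α • e + ψ⟫ =
      ⟪ψ - M₀ ψ, ψ⟫ + t ^ 2 * (α ^ 2 * β + 2 * α * ⟪M₂ e, ψ⟫ + ⟪M₂ ψ, ψ⟫) := by
    rw [perturbedOp_apply, hfix, inner_add_left, inner_sub_left, real_inner_smul_left,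
      h.inner_skew_self, real_inner_smul_left, inner_add_right, real_inner_smul_right, horth]
    have h2 : ⟪M₂ (α • e + ψ), α • e + ψ⟫ =
        α ^ 2 * β + 2 * α * ⟪M₂ e, ψ⟫ + ⟪M₂ ψ, ψ⟫ := by
      simp only [map_add, map_smul, inner_add_left, inner_add_right, real_inner_smul_left,
        real_inner_smul_right]
      rw [h.symm₂ ψ e, real_inner_comm (M₂ e) ψ, h.symm₂ e e]
      ring
    rw [h2]; ring
  rw [hexp]
  have h1 := h.gap_inner hψ
  have h2 : -(m * n * ‖ψ‖) ≤ ⟪M₂ e, ψ⟫ ∧ ⟪M₂ e, ψ⟫ ≤ m * n * ‖ψ‖ := by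
    rw [← abs_le]
    exact (abs_real_inner_le_norm _ _).trans
      (mul_le_mul_of_nonneg_right (M₂.le_opNorm e) (norm_nonneg _))
  have h3 : -(m * ‖ψ‖ ^ 2) ≤ ⟪M₂ ψ, ψ⟫ := by
    have := (abs_real_inner_le_norm (M₂ ψ) ψ).trans
      (mul_le_mul_of_nonneg_right (M₂.le_opNorm ψ) (norm_nonneg _))
    have := (abs_le.mp this).1
    nlinarith
  have h4 : α ^ 2 * β / 2 - D * ‖ψ‖ ^ 2 ≤ α ^ 2 * β + 2 * α * ⟪M₂ e, ψ⟫ + ⟪M₂ ψ, ψ⟫ := by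
    set z := ⟪M₂ e, ψ⟫
    have hz : z ^ 2 ≤ (m * n * ‖ψ‖) ^ 2 := sq_le_sq' h2.1 h2.2
    have h5 : 0 ≤ α ^ 2 * β / 2 + 2 * α * z + 2 * z ^ 2 / β := by
      have : α ^ 2 * β / 2 + 2 * α * z + 2 * z ^ 2 / β = (α * β + 2 * z) ^ 2 / (2 * β) := by
        field_simp; ring
      rw [this]; positivity
    have h6 : 2 * z ^ 2 / β ≤ 2 * (m * n) ^ 2 / β * ‖ψ‖ ^ 2 := by
      rw [div_mul_eq_mul_div]
      apply div_le_div_of_nonneg_right _ hβ0.le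
      nlinarith
    rw [hD]; nlinarith
  have h5 : t ^ 2 * (α ^ 2 * β / 2 - D * ‖ψ‖ ^ 2) ≤
      t ^ 2 * (α ^ 2 * β + 2 * α * ⟪M₂ e, ψ⟫ + ⟪M₂ ψ, ψ⟫) :=
    mul_le_mul_of_nonneg_left h4 (sq_nonneg _)
  have h6 : t ^ 2 * D * ‖ψ‖ ^ 2 ≤ (1 - q) / 2 * ‖ψ‖ ^ 2 :=
    mul_le_mul_of_nonneg_right htD (sq_nonneg _)
  have h7 : min ((1 - q) / 2) (β / 2) * ‖ψ‖ ^ 2 ≤ (1 - q) / 2 * ‖ψ‖ ^ 2 :=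
    mul_le_mul_of_nonneg_right (min_le_left _ _) (sq_nonneg _)
  have h8 : min ((1 - q) / 2) (β / 2) * (t ^ 2 * α ^ 2) ≤ β / 2 * (t ^ 2 * α ^ 2) :=
    mul_le_mul_of_nonneg_right (min_le_right _ _) (by positivity)
  nlinarith

lemma exists_decomposition (h : GappedTriple M₀ M₁ M₂ e q) (x : H) :
    ∃ (α : ℝ) (ψ : H), ⟪e, ψ⟫ = 0 ∧ x = α • e + ψ := by
  refine ⟨⟪e, x⟫ / ‖e‖ ^ 2, x - (⟪e, x⟫ / ‖e‖ ^ 2) • e, ?_, by abel⟩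
  have : ‖e‖ ≠ 0 := norm_ne_zero_iff.mpr h.ne_zero
  rw [inner_sub_right, real_inner_smul_right, real_inner_self_eq_norm_sq]
  field_simp
  ring

/-- For small parameters the perturbed operator is bijective. -/
lemma exists_unique_solution [CompleteSpace H] (h : GappedTriple M₀ M₁ M₂ e q) :
    ∃ t₀ > 0, ∀ t : ℝ, 0 < t → t < t₀ → Function.Bijective (perturbedOp M₀ M₁ M₂ t) := by
  obtain ⟨t₀, ht₀, c, hc, hen⟩ := h.energy
  refine ⟨t₀, ht₀, fun t ht htt => ?_⟩
  set L := perturbedOp M₀ M₁ M₂ t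
  have hn : 0 < ‖e‖ := norm_pos_iff.mpr h.ne_zero
  -- Lax–Milgram: `energy` gives coercivity for each fixed `t > 0`, with a constant that degenerates
  -- like `t²` in the direction `e`.
  have hco : IsCoercive ((innerSL ℝ).comp L) := by
    refine ⟨c * min 1 (t ^ 2 / ‖e‖ ^ 2), by positivity, fun x => ?_⟩
    obtain ⟨α, ψ, hψ, rfl⟩ := h.exists_decomposition x
    refine le_trans ?_ (hen t ht htt α ψ hψ)
    have hnorm : ‖α • e + ψ‖ * ‖α • e + ψ‖ = α ^ 2 * ‖e‖ ^ 2 + ‖ψ‖ ^ 2 := by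
      rw [norm_add_sq_eq_norm_sq_add_norm_sq_real, norm_smul, Real.norm_eq_abs]
      · nlinarith [sq_abs α]
      · rw [real_inner_smul_left, hψ, mul_zero]
    rw [mul_assoc, hnorm, mul_assoc]
    refine mul_le_mul_of_nonneg_left ?_ hc.le
    have h1 : min 1 (t ^ 2 / ‖e‖ ^ 2) * ‖ψ‖ ^ 2 ≤ 1 * ‖ψ‖ ^ 2 :=
      mul_le_mul_of_nonneg_right (min_le_left _ _) (sq_nonneg _)
    have h2 : min 1 (t ^ 2 / ‖e‖ ^ 2) * (α ^ 2 * ‖e‖ ^ 2) ≤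
        t ^ 2 / ‖e‖ ^ 2 * (α ^ 2 * ‖e‖ ^ 2) :=
      mul_le_mul_of_nonneg_right (min_le_right _ _) (by positivity)
    have h3 : t ^ 2 / ‖e‖ ^ 2 * (α ^ 2 * ‖e‖ ^ 2) = t ^ 2 * α ^ 2 := by
      field_simp
    nlinarith
  have hL : ∀ x, hco.continuousLinearEquivOfBilin x = L x := fun x =>
    (hco.unique_continuousLinearEquivOfBilin (fun y => by simp)).symm
  have : (L : H → H) = hco.continuousLinearEquivOfBilin := funext fun x => (hL x).symm
  rw [this]
  exact hco.continuousLinearEquivOfBilin.bijective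

/-- Neumann series for `1 - M₀` on the orthogonal complement of `e`. -/
lemma exists_neumann [CompleteSpace H] (h : GappedTriple M₀ M₁ M₂ e q) {g : H}
    (hg : ⟪e, g⟫ = 0) :
    ∃ v : H, v - M₀ v = g ∧ HasSum (fun m : ℕ => ⟪g, (M₀^[m]) g⟫) ⟪g, v⟫ ∧ 0 ≤ ⟪g, v⟫ := by
  -- The complement of `e` is invariant under `M₀`, so the gap applies to every iterate and the
  -- series is dominated by a geometric one.
  have horth : ∀ m : ℕ, ⟪e, (M₀^[m]) g⟫ = 0 := by
    intro m
    induction m with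
    | zero => simpa using hg
    | succ k ih => rw [Function.iterate_succ_apply', ← h.symm₀, h.fix, ih]
  have hbd : ∀ m : ℕ, ‖(M₀^[m]) g‖ ≤ ‖g‖ * q ^ m := by
    intro m
    induction m with
    | zero => simp
    | succ k ih =>
      rw [Function.iterate_succ_apply']
      refine (h.gap _ (horth k)).trans ?_
      calc q * ‖(M₀^[k]) g‖ ≤ q * (‖g‖ * q ^ k) := mul_le_mul_of_nonneg_left ih h.nonneg
        _ = ‖g‖ * q ^ (k + 1) := by ring
  have hsum : Summable (fun m : ℕ => (M₀^[m]) g) :=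
    Summable.of_norm_bounded ((summable_geometric_of_lt_one h.nonneg h.lt_one).mul_left _) hbd
  set v := ∑' m : ℕ, (M₀^[m]) g
  have hv : v - M₀ v = g := by
    have h1 : M₀ v = ∑' m : ℕ, (M₀^[m + 1]) g := by
      rw [M₀.map_tsum hsum]
      simp only [Function.iterate_succ_apply']
    have h2 : v = (M₀^[0]) g + ∑' m : ℕ, (M₀^[m + 1]) g := hsum.tsum_eq_zero_add
    rw [h1]
    nth_rewrite 1 [h2]
    simp
  have hin : ∀ u : H, HasSum (fun m : ℕ => ⟪u, (M₀^[m]) g⟫) ⟪u, v⟫ := fun u =>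
    hsum.hasSum.mapL (innerSL ℝ u)
  have hev : ⟪e, v⟫ = 0 := by
    have := hin e
    simp only [horth] at this
    exact this.unique hasSum_zero
  refine ⟨v, hv, hin g, ?_⟩
  have := h.gap_inner hev
  rw [hv] at this
  exact le_trans (mul_nonneg (by linarith [h.lt_one]) (sq_nonneg _)) this

/-- The vector `e - t v` is nearly annihilated by the adjoint `1 - M₀ + t M₁ + t² M₂`: the terms of
order `1` and `t` cancel by `M₀ e = e` and the equation for `v`. What survives at order `t²` in the
direction `e` is the constant of the limit. -/
lemma inner_perturbedOp_test (h : GappedTriple M₀ M₁ M₂ e q) {v ψ : H}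
    (hv : v - M₀ v = M₁ e) (hψ : ⟪e, ψ⟫ = 0) (t α : ℝ) :
    ⟪perturbedOp M₀ M₁ M₂ t (α • e + ψ), e - t • v⟫ =
      t ^ 2 * α * (⟪e, M₂ e⟫ + ⟪M₁ e, v⟫) + t ^ 2 * ⟪ψ, M₂ e - M₁ v⟫
        - t ^ 3 * (α * ⟪e, M₂ v⟫ + ⟪ψ, M₂ v⟫) := by
  have hM₀ : M₀ v = v - M₁ e := by rw [← hv]; abel
  rw [perturbedOp_apply]
  simp only [map_add, map_smul, inner_add_left, inner_sub_left, inner_sub_right,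
    real_inner_smul_left, real_inner_smul_right, h.fix, h.symm₀ ψ, h.skew₁ ψ,
    h.symm₂ _ v, h.symm₂ _ e, hM₀, h.inner_skew_self]
  rw [real_inner_comm e ψ, hψ]
  ring_nf

set_option maxHeartbeats 400000 in
/-- Leading asymptotics of the solutions of the perturbed equation. -/
lemma tendsto_sq_mul_inner (h : GappedTriple M₀ M₁ M₂ e q) {v b : H}
    (hv : v - M₀ v = M₁ e) (hb : ⟪e, b⟫ = 1) (hκ : 0 < ⟪e, M₂ e⟫ + ⟪M₁ e, v⟫) {F : ℝ → H}
    (hF : ∀ᶠ t in 𝓝[>] (0 : ℝ), perturbedOp M₀ M₁ M₂ t (F t) = b) :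
    Tendsto (fun t => t ^ 2 * ⟪b, F t⟫) (𝓝[>] 0) (𝓝 (1 / (⟪e, M₂ e⟫ + ⟪M₁ e, v⟫))) := by
  obtain ⟨t₀, ht₀, c, hc, hen⟩ := h.energy
  set κ := ⟪e, M₂ e⟫ + ⟪M₁ e, v⟫ with hκdef
  set B := ‖b‖ with hB
  have hB0 : 0 ≤ B := norm_nonneg _
  -- A priori bound for both `t ‖ψ‖` and `t² |α|`: multiply the energy estimate, whose right side is
  -- `α + ⟪b, ψ⟫`, by `t²` and complete squares.
  set k := (1 + B) / c with hk
  have hk0 : 0 < k := by positivity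
  set C := (B * ‖v‖ + k * ‖M₂ e - M₁ v‖ + (k * |⟪e, M₂ v⟫| + k * ‖M₂ v‖)) / κ + B * k with hC
  have hkey : ∀ᶠ t in 𝓝[>] (0 : ℝ), ‖t ^ 2 * ⟪b, F t⟫ - 1 / κ‖ ≤ C * t := by
    have hsmall : ∀ᶠ t in 𝓝[>] (0 : ℝ), t < min 1 t₀ :=
      (eventually_lt_nhds (by positivity)).filter_mono nhdsWithin_le_nhds
    filter_upwards [hF, hsmall, self_mem_nhdsWithin] with t htF hts ht
    have ht : 0 < t := ht
    have ht1 : t < 1 := hts.trans_le (min_le_left _ _)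
    obtain ⟨α, ψ, hψ, hx⟩ := h.exists_decomposition (F t)
    have hE := hen t ht (hts.trans_le (min_le_right _ _)) α ψ hψ
    have hT := h.inner_perturbedOp_test hv hψ t α
    rw [← hx, htF] at hE hT
    have hbF : ⟪b, F t⟫ = α + ⟪b, ψ⟫ := by
      rw [hx, inner_add_right, real_inner_smul_right, real_inner_comm, hb, mul_one]
    have hbψ : |⟪b, ψ⟫| ≤ B * ‖ψ‖ := abs_real_inner_le_norm _ _
    have hbound : (t * ‖ψ‖) ^ 2 + (t ^ 2 * α) ^ 2 ≤ k ^ 2 := by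
      have h1 : c * (‖ψ‖ ^ 2 + t ^ 2 * α ^ 2) ≤ α + B * ‖ψ‖ := by
        rw [hbF] at hE; linarith [le_abs_self ⟪b, ψ⟫]
      have h2 : c * ((t * ‖ψ‖) ^ 2 + (t ^ 2 * α) ^ 2) ≤ (t ^ 2 * α) + B * (t * ‖ψ‖) * t := by
        have := mul_le_mul_of_nonneg_left h1 (sq_nonneg t)
        nlinarith
      set X := t * ‖ψ‖
      set Y := t ^ 2 * α
      have hX : 0 ≤ X := by positivity
      have h3 : c * (X ^ 2 + Y ^ 2) ≤ Y + B * X := by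
        have : B * X * t ≤ B * X := mul_le_of_le_one_right (by positivity) ht1.le
        linarith
      have h4 : (c * X) ^ 2 + (c * Y) ^ 2 ≤ (1 + B) ^ 2 := by
        nlinarith [sq_nonneg (c * Y - 1), sq_nonneg (c * X - B), mul_le_mul_of_nonneg_left h3 hc.le]
      rw [hk, div_pow, le_div_iff₀ (by positivity)]
      nlinarith
    have hX : t * ‖ψ‖ ≤ k :=
      abs_le_of_sq_le_sq' (by nlinarith [sq_nonneg (t ^ 2 * α)]) hk0.le |>.2
    have hY : |t ^ 2 * α| ≤ k :=
      abs_le_of_sq_le_sq (by nlinarith [sq_nonneg (t * ‖ψ‖)]) hk0.le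
    have hR1 : |t ^ 2 * ⟪ψ, M₂ e - M₁ v⟫| ≤ t * (k * ‖M₂ e - M₁ v‖) := by
      have := abs_real_inner_le_norm ψ (M₂ e - M₁ v)
      rw [abs_mul, abs_of_pos (by positivity : 0 < t ^ 2)]
      calc t ^ 2 * |⟪ψ, M₂ e - M₁ v⟫| ≤ t ^ 2 * (‖ψ‖ * ‖M₂ e - M₁ v‖) := by gcongr
        _ = t * ((t * ‖ψ‖) * ‖M₂ e - M₁ v‖) := by ring
        _ ≤ _ := by gcongr
    have hR2 : |t ^ 3 * (α * ⟪e, M₂ v⟫ + ⟪ψ, M₂ v⟫)| ≤ t * (k * |⟪e, M₂ v⟫| + k * ‖M₂ v‖) := by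
      have h1 : t ^ 3 * (α * ⟪e, M₂ v⟫ + ⟪ψ, M₂ v⟫) =
          t * ((t ^ 2 * α) * ⟪e, M₂ v⟫ + t ^ 2 * ⟪ψ, M₂ v⟫) := by ring
      rw [h1, abs_mul, abs_of_pos ht]
      gcongr
      refine (abs_add_le _ _).trans (add_le_add ?_ ?_)
      · rw [abs_mul]; gcongr
      · rw [abs_mul, abs_of_pos (by positivity : 0 < t ^ 2)]
        calc t ^ 2 * |⟪ψ, M₂ v⟫| ≤ t ^ 2 * (‖ψ‖ * ‖M₂ v‖) := by
              gcongr; exact abs_real_inner_le_norm _ _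
          _ = t * ((t * ‖ψ‖) * ‖M₂ v‖) := by ring
          _ ≤ 1 * (k * ‖M₂ v‖) := by gcongr
          _ = _ := one_mul _
    have hR0 : |t * ⟪b, v⟫| ≤ t * (B * ‖v‖) := by
      rw [abs_mul, abs_of_pos ht]; gcongr; exact abs_real_inner_le_norm _ _
    have hbχ : ⟪b, e - t • v⟫ = 1 - t * ⟪b, v⟫ := by
      rw [inner_sub_right, real_inner_smul_right, real_inner_comm, hb]
    rw [hbχ] at hT
    have hακ : |t ^ 2 * α * κ - 1| ≤
        t * (B * ‖v‖ + k * ‖M₂ e - M₁ v‖ + (k * |⟪e, M₂ v⟫| + k * ‖M₂ v‖)) := by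
      have h1 : t ^ 2 * α * κ - 1 = -(t * ⟪b, v⟫) - t ^ 2 * ⟪ψ, M₂ e - M₁ v⟫ +
          t ^ 3 * (α * ⟪e, M₂ v⟫ + ⟪ψ, M₂ v⟫) := by linarith
      rw [h1, abs_le]
      rw [abs_le] at hR0 hR1 hR2
      constructor <;> linarith [hR0.1, hR0.2, hR1.1, hR1.2, hR2.1, hR2.2]
    have hα : |t ^ 2 * α - 1 / κ| ≤
        t * ((B * ‖v‖ + k * ‖M₂ e - M₁ v‖ + (k * |⟪e, M₂ v⟫| + k * ‖M₂ v‖)) / κ) := by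
      have h1 : t ^ 2 * α - 1 / κ = (t ^ 2 * α * κ - 1) / κ := by field_simp
      rw [h1, abs_div, abs_of_pos hκ, ← mul_div_assoc]
      gcongr
    have hψ2 : |t ^ 2 * ⟪b, ψ⟫| ≤ t * (B * k) := by
      rw [abs_mul, abs_of_pos (by positivity : 0 < t ^ 2)]
      calc t ^ 2 * |⟪b, ψ⟫| ≤ t ^ 2 * (B * ‖ψ‖) := by gcongr
        _ = t * (B * (t * ‖ψ‖)) := by ring
        _ ≤ _ := by gcongr
    have hfin : t ^ 2 * ⟪b, F t⟫ - 1 / κ = (t ^ 2 * α - 1 / κ) + t ^ 2 * ⟪b, ψ⟫ := by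
      rw [hbF]; ring
    rw [hfin, Real.norm_eq_abs]
    refine (abs_add_le _ _).trans ?_
    rw [hC]
    linarith
  rw [tendsto_iff_norm_sub_tendsto_zero]
  refine squeeze_zero' (Eventually.of_forall fun _ => norm_nonneg _) hkey ?_
  have : Tendsto (fun t : ℝ => C * t) (𝓝 0) (𝓝 (C * 0)) := (continuous_const_mul C).tendsto 0
  rw [mul_zero] at this
  exact this.mono_left nhdsWithin_le_nhds

end GappedTriple

end Abstract

/-! ### Integral operators on `L²` dominated by a convolution -/

section Schur

lemma integral_mul_sub_sq {α : Type*} [MeasurableSpace α] {μ : Measure α} {k f : α → ℝ}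
    (hk : Integrable k μ) (hkf : Integrable (fun y => k y * f y) μ)
    (hkf2 : Integrable (fun y => k y * f y ^ 2) μ) (m : ℝ) :
    Integrable (fun y => k y * (f y - m) ^ 2) μ ∧
    ∫ y, k y * (f y - m) ^ 2 ∂μ =
      ∫ y, k y * f y ^ 2 ∂μ - 2 * m * ∫ y, k y * f y ∂μ + m ^ 2 * ∫ y, k y ∂μ := by
  have h1 : (fun y => k y * (f y - m) ^ 2) =
      fun y => (k y * f y ^ 2 - 2 * m * (k y * f y)) + m ^ 2 * k y := by
    ext y; ring
  have h2 : Integrable (fun y => k y * f y ^ 2 - 2 * m * (k y * f y)) μ :=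
    hkf2.sub (hkf.const_mul _)
  refine ⟨?_, ?_⟩
  · rw [h1]; exact h2.add (hk.const_mul _)
  · rw [h1, integral_add h2 (hk.const_mul _),
      integral_sub hkf2 (hkf.const_mul _), integral_const_mul, integral_const_mul]

/-- Cauchy–Schwarz with weight `k`, from the nonnegativity of the quadratic `∫ k (f - m)²` in `m`.
If `∫ k = 0` the quadratic is affine, which forces its slope to vanish. -/
lemma sq_integral_mul_le {α : Type*} [MeasurableSpace α] {μ : Measure α} {k f : α → ℝ}
    (hk0 : ∀ y, 0 ≤ k y) (hk : Integrable k μ) (hkf : Integrable (fun y => k y * f y) μ)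
    (hkf2 : Integrable (fun y => k y * f y ^ 2) μ) :
    (∫ y, k y * f y ∂μ) ^ 2 ≤ (∫ y, k y ∂μ) * ∫ y, k y * f y ^ 2 ∂μ := by
  set A := ∫ y, k y ∂μ with hA
  set B := ∫ y, k y * f y ∂μ with hB
  set D := ∫ y, k y * f y ^ 2 ∂μ with hD
  have hA0 : 0 ≤ A := integral_nonneg hk0
  have key : ∀ m : ℝ, 0 ≤ D - 2 * m * B + m ^ 2 * A := fun m => by
    rw [← (integral_mul_sub_sq hk hkf hkf2 m).2]
    exact integral_nonneg fun y => mul_nonneg (hk0 y) (sq_nonneg _)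
  rcases hA0.eq_or_lt with h | h
  · have h1 := key ((D + 1) / (2 * B))
    have hB0 : B = 0 := by
      by_contra hne
      rw [← h, mul_zero, add_zero] at h1
      have : 2 * ((D + 1) / (2 * B)) * B = D + 1 := by field_simp
      linarith
    rw [hB0, ← h]; simp
  · have h1 := key (B / A)
    have : D - 2 * (B / A) * B + (B / A) ^ 2 * A = (A * D - B ^ 2) / A := by
      field_simp; ring
    rw [this] at h1
    have := (div_nonneg_iff.mp h1)
    rcases this with h2 | h2 <;> linarith [h2.1, h2.2]

/-- The integral operator with kernel `N`. -/
noncomputable def intOp (N : ℝ → ℝ → ℝ) (F : ℝ → ℝ) : ℝ → ℝ := fun x => ∫ y, N x y * F y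

/-- The kernel `N` is dominated by the convolution kernel of an even function in `L¹ ∩ L²`. -/
structure KernelDominated (N : ℝ → ℝ → ℝ) (k : ℝ → ℝ) : Prop where
  measurable : Measurable (Function.uncurry N)
  bound : ∀ x y, |N x y| ≤ k (x - y)
  integrable : Integrable k
  memLp : MemLp k 2 volume
  even : ∀ z, k (-z) = k z

namespace KernelDominated

variable {N : ℝ → ℝ → ℝ} {k F G : ℝ → ℝ}

lemma nonneg (hN : KernelDominated N k) (z : ℝ) : 0 ≤ k z := by
  have := hN.bound z 0
  rw [sub_zero] at this
  exact (abs_nonneg _).trans this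

lemma measurable_section (hN : KernelDominated N k) (x : ℝ) : Measurable (N x) :=
  hN.measurable.comp measurable_prodMk_left

lemma memLp_section (hN : KernelDominated N k) (x : ℝ) : MemLp (N x) 2 volume := by
  have h1 : MemLp (fun y => k (x - y)) 2 volume :=
    hN.memLp.comp_measurePreserving (volume.measurePreserving_sub_left x)
  exact h1.mono (hN.measurable_section x).aestronglyMeasurable
    (Eventually.of_forall fun y => (hN.bound x y).trans (le_abs_self _))

lemma integrable_section (hN : KernelDominated N k) (hF : MemLp F 2 volume) (x : ℝ) :
    Integrable (fun y => N x y * F y) :=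
  (hN.memLp_section x).integrable_mul hF

lemma integrable_prod_sq (hN : KernelDominated N k) (hF : MemLp F 2 volume) :
    Integrable (fun p : ℝ × ℝ => k (p.1 - p.2) * F p.2 ^ 2) (volume.prod volume) := by
  have := Integrable.convolution_integrand (ContinuousLinearMap.mul ℝ ℝ) hF.integrable_sq
    hN.integrable
  refine this.congr (Eventually.of_forall fun p => ?_)
  simp [mul_comm]

lemma integrable_prod_sq_swap (hN : KernelDominated N k) (hF : MemLp F 2 volume) :
    Integrable (fun p : ℝ × ℝ => k (p.1 - p.2) * F p.1 ^ 2) (volume.prod volume) := by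
  refine (hN.integrable_prod_sq hF).swap.congr (Eventually.of_forall fun p => ?_)
  simp only [Function.comp, Prod.fst_swap, Prod.snd_swap]
  rw [← hN.even, neg_sub]

lemma aestronglyMeasurable_prod (hN : KernelDominated N k) (hF : MemLp F 2 volume) :
    AEStronglyMeasurable (fun p : ℝ × ℝ => N p.1 p.2 * F p.2) (volume.prod volume) :=
  hN.measurable.aestronglyMeasurable.mul hF.aestronglyMeasurable.comp_snd

lemma integrable_prod (hN : KernelDominated N k) (hF : MemLp F 2 volume)
    (hG : MemLp G 2 volume) :
    Integrable (fun p : ℝ × ℝ => N p.1 p.2 * F p.2 * G p.1) (volume.prod volume) := by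
  refine ((hN.integrable_prod_sq hF).add (hN.integrable_prod_sq_swap hG)).mono'
    ((hN.aestronglyMeasurable_prod hF).mul hG.aestronglyMeasurable.comp_fst)
    (Eventually.of_forall fun p => ?_)
  simp only [Pi.add_apply, Real.norm_eq_abs, abs_mul]
  have h1 := hN.bound p.1 p.2
  have h2 := hN.nonneg (p.1 - p.2)
  calc |N p.1 p.2| * |F p.2| * |G p.1| ≤ k (p.1 - p.2) * |F p.2| * |G p.1| := by gcongr
    _ = k (p.1 - p.2) * (|F p.2| * |G p.1|) := by ring
    _ ≤ k (p.1 - p.2) * (F p.2 ^ 2 + G p.1 ^ 2) := by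
        gcongr
        nlinarith [sq_abs (F p.2), sq_abs (G p.1), sq_nonneg (|F p.2| - |G p.1|),
          sq_nonneg (F p.2), sq_nonneg (G p.1)]
    _ = _ := by ring

/-- Pointwise form of Schur's test: Cauchy–Schwarz with weight `k (x - y)`. Integrating in `x` by
Fubini and translation invariance then gives operator norm at most `∫ k`. -/
lemma sq_intOp_le (hN : KernelDominated N k) (hF : MemLp F 2 volume) :
    ∀ᵐ x, intOp N F x ^ 2 ≤ (∫ z, k z) * ∫ y, k (x - y) * F y ^ 2 := by
  filter_upwards [(hN.integrable_prod_sq hF).prod_right_ae] with x hx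
  have hk : Integrable (fun y => k (x - y)) := hN.integrable.comp_sub_left x
  have hkL : MemLp (fun y => k (x - y)) 2 volume :=
    hN.memLp.comp_measurePreserving (volume.measurePreserving_sub_left x)
  have hkF : Integrable (fun y => k (x - y) * |F y|) := hkL.integrable_mul hF.norm
  have h1 := sq_integral_mul_le (fun y => hN.nonneg (x - y)) hk hkF (by simpa using hx)
  rw [integral_sub_left_eq_self k volume x] at h1
  simp only [sq_abs] at h1
  refine le_trans ?_ h1
  apply sq_le_sq'
  · have : |intOp N F x| ≤ ∫ y, k (x - y) * |F y| := by
      refine (abs_integral_le_integral_abs).trans ?_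
      refine integral_mono (hN.integrable_section hF x).abs hkF fun y => ?_
      simp only [abs_mul]
      exact mul_le_mul_of_nonneg_right (hN.bound x y) (abs_nonneg _)
    linarith [neg_abs_le (intOp N F x)]
  · refine integral_mono (hN.integrable_section hF x) hkF fun y => ?_
    calc N x y * F y ≤ |N x y * F y| := le_abs_self _
      _ = |N x y| * |F y| := abs_mul _ _
      _ ≤ _ := mul_le_mul_of_nonneg_right (hN.bound x y) (abs_nonneg _)

lemma aestronglyMeasurable_intOp (hN : KernelDominated N k) (hF : MemLp F 2 volume) :
    AEStronglyMeasurable (intOp N F) volume :=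
  (hN.aestronglyMeasurable_prod hF).integral_prod_right'

lemma memLp_intOp (hN : KernelDominated N k) (hF : MemLp F 2 volume) :
    MemLp (intOp N F) 2 volume := by
  rw [memLp_two_iff_integrable_sq (hN.aestronglyMeasurable_intOp hF)]
  refine Integrable.mono' ((hN.integrable_prod_sq hF).integral_prod_left.const_mul (∫ z, k z))
    ((hN.aestronglyMeasurable_intOp hF).pow 2) ?_
  filter_upwards [hN.sq_intOp_le hF] with x hx
  rw [Real.norm_of_nonneg (sq_nonneg _)]
  exact hx

lemma integral_sq_intOp_le (hN : KernelDominated N k) (hF : MemLp F 2 volume) :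
    ∫ x, intOp N F x ^ 2 ≤ (∫ z, k z) ^ 2 * ∫ x, F x ^ 2 := by
  have h1 : ∫ x, intOp N F x ^ 2 ≤ ∫ x, (∫ z, k z) * ∫ y, k (x - y) * F y ^ 2 :=
    integral_mono_ae (hN.memLp_intOp hF).integrable_sq
      ((hN.integrable_prod_sq hF).integral_prod_left.const_mul (∫ z, k z)) (hN.sq_intOp_le hF)
  refine h1.trans (le_of_eq ?_)
  rw [integral_const_mul, integral_integral_swap (hN.integrable_prod_sq hF)]
  simp only [integral_mul_const]
  simp only [fun y => integral_sub_right_eq_self (μ := volume) k y]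
  rw [integral_const_mul]
  ring

lemma intOp_congr (N : ℝ → ℝ → ℝ) (h : F =ᵐ[volume] G) : intOp N F = intOp N G := by
  ext x
  refine integral_congr_ae ?_
  filter_upwards [h] with y hy
  rw [hy]

lemma intOp_add (hN : KernelDominated N k) (hF : MemLp F 2 volume) (hG : MemLp G 2 volume) :
    intOp N (F + G) = intOp N F + intOp N G := by
  ext x
  simp only [intOp, Pi.add_apply, mul_add]
  exact integral_add (hN.integrable_section hF x) (hN.integrable_section hG x)

lemma _root_.intOp_smul (N : ℝ → ℝ → ℝ) (c : ℝ) (F : ℝ → ℝ) :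
    intOp N (c • F) = c • intOp N F := by
  ext x
  simp only [intOp, Pi.smul_apply, smul_eq_mul, ← integral_const_mul]
  congr 1; ext y; ring

lemma _root_.norm_toLp_sq (hF : MemLp F 2 volume) : ‖hF.toLp F‖ ^ 2 = ∫ x, F x ^ 2 := by
  rw [← real_inner_self_eq_norm_sq, L2.inner_def]
  refine integral_congr_ae ?_
  filter_upwards [hF.coeFn_toLp] with x hx
  simp [hx, sq]

lemma _root_.inner_toLp_toLp (hF : MemLp F 2 volume) (hG : MemLp G 2 volume) :
    ⟪hF.toLp F, hG.toLp G⟫ = ∫ x, F x * G x := by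
  rw [L2.inner_def]
  refine integral_congr_ae ?_
  filter_upwards [hF.coeFn_toLp, hG.coeFn_toLp] with x hx hy
  simp [hx, hy, mul_comm]

/-- A dominated kernel defines a bounded operator on `L²`. -/
noncomputable def opL (hN : KernelDominated N k) : Lp ℝ 2 (volume : Measure ℝ) →L[ℝ]
    Lp ℝ 2 (volume : Measure ℝ) :=
  LinearMap.mkContinuous
    { toFun := fun F => (hN.memLp_intOp (Lp.memLp F)).toLp (intOp N F)
      map_add' := fun F G => by
        rw [← MemLp.toLp_add]
        congr 1
        rw [intOp_congr N (Lp.coeFn_add F G), hN.intOp_add (Lp.memLp F) (Lp.memLp G)]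
      map_smul' := fun c F => by
        rw [RingHom.id_apply, ← MemLp.toLp_const_smul]
        congr 1
        rw [intOp_congr N (Lp.coeFn_smul c F), intOp_smul] }
    (∫ z, k z) fun F => by
      have h0 : 0 ≤ ∫ z, k z := integral_nonneg hN.nonneg
      refine abs_le_of_sq_le_sq' ?_ (by positivity) |>.2
      simp only [LinearMap.coe_mk, AddHom.coe_mk]
      rw [norm_toLp_sq, mul_pow]
      refine (hN.integral_sq_intOp_le (Lp.memLp F)).trans (le_of_eq ?_)
      rw [← norm_toLp_sq (Lp.memLp F), Lp.toLp_coeFn]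

lemma opL_apply (hN : KernelDominated N k) (F : Lp ℝ 2 (volume : Measure ℝ)) :
    hN.opL F = (hN.memLp_intOp (Lp.memLp F)).toLp (intOp N F) := rfl

lemma coeFn_opL (hN : KernelDominated N k) (F : Lp ℝ 2 (volume : Measure ℝ)) :
    hN.opL F =ᵐ[volume] intOp N F := (hN.memLp_intOp (Lp.memLp F)).coeFn_toLp

lemma opL_toLp (hN : KernelDominated N k) (hF : MemLp F 2 volume) :
    hN.opL (hF.toLp F) = (hN.memLp_intOp hF).toLp (intOp N F) := by
  rw [opL_apply]
  congr 1
  exact intOp_congr N hF.coeFn_toLp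

lemma norm_opL_le (hN : KernelDominated N k) (F : Lp ℝ 2 (volume : Measure ℝ)) :
    ‖hN.opL F‖ ≤ (∫ z, k z) * ‖F‖ :=
  (hN.opL.le_opNorm F).trans (mul_le_mul_of_nonneg_right
    (LinearMap.mkContinuous_norm_le _ (integral_nonneg hN.nonneg) _) (norm_nonneg _))

lemma inner_opL (hN : KernelDominated N k) (F G : Lp ℝ 2 (volume : Measure ℝ)) :
    ⟪hN.opL F, G⟫ = ∫ x, ∫ y, N x y * F y * G x := by
  rw [L2.inner_def]
  refine integral_congr_ae ?_
  filter_upwards [hN.coeFn_opL F] with x hx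
  rw [integral_mul_const, hx]
  simp [intOp, mul_comm]

/-- Fubini transfers the parity of the kernel to the operator: `c = 1` gives symmetry, `c = -1`
skewness. -/
lemma inner_opL_swap (hN : KernelDominated N k) {c : ℝ} (hc : ∀ x y, N y x = c * N x y)
    (F G : Lp ℝ 2 (volume : Measure ℝ)) : ⟪hN.opL F, G⟫ = c * ⟪F, hN.opL G⟫ := by
  rw [real_inner_comm (hN.opL G) F, inner_opL, inner_opL,
    integral_integral_swap (hN.integrable_prod (Lp.memLp F) (Lp.memLp G)),
    ← integral_const_mul]
  congr 1; ext x
  rw [← integral_const_mul]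
  congr 1; ext y
  rw [hc]; ring

end KernelDominated

end Schur

/-! ### The dimensionless kernel and bounds for the relaxation rate -/

noncomputable section

namespace Bloch

/-- The translation invariant part `z² sgn z / (2 sinh (z/2))` of the symmetrized kernel. -/
def hker (z : ℝ) : ℝ := z ^ 2 * Real.sign z / (2 * Real.sinh (z / 2))

/-- `cosh (x/2)`, so that the weight is `1 / (4 cosh² (x/2))`. -/
def ch (x : ℝ) : ℝ := Real.cosh (x / 2)

lemma ch_pos (x : ℝ) : 0 < ch x := Real.cosh_pos _

lemma ch_neg (x : ℝ) : ch (-x) = ch x := by simp [ch, neg_div]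

lemma continuous_ch : Continuous ch := by unfold ch; fun_prop

lemma one_le_ch (x : ℝ) : 1 ≤ ch x := Real.one_le_cosh _

lemma ch_le_exp (x : ℝ) : ch x ≤ Real.exp (|x| / 2) := by
  have h : Real.cosh (x / 2) = Real.cosh (|x| / 2) := by
    rw [← Real.cosh_abs (x / 2), abs_div, abs_two]
  rw [ch, h, Real.cosh_eq]
  have : Real.exp (-(|x| / 2)) ≤ Real.exp (|x| / 2) :=
    Real.exp_le_exp.mpr (by linarith [abs_nonneg x])
  linarith

lemma exp_le_ch (x : ℝ) : Real.exp (|x| / 2) / 2 ≤ ch x := by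
  have h : Real.cosh (x / 2) = Real.cosh (|x| / 2) := by
    rw [← Real.cosh_abs (x / 2), abs_div, abs_two]
  rw [ch, h, Real.cosh_eq]
  linarith [Real.exp_pos (-(|x| / 2))]

lemma hker_neg (z : ℝ) : hker (-z) = hker z := by
  simp only [hker, neg_sq, Real.sign_neg, neg_div, Real.sinh_neg, mul_neg, div_neg, neg_neg]

lemma hker_abs (z : ℝ) : hker |z| = hker z := by
  rcases abs_choice z with h | h <;> rw [h]
  exact hker_neg z

lemma hker_of_pos {z : ℝ} (hz : 0 < z) : hker z = z ^ 2 / (2 * Real.sinh (z / 2)) := by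
  rw [hker, Real.sign_of_pos hz, mul_one]

lemma hker_zero : hker 0 = 0 := by simp [hker]

lemma le_hker (z : ℝ) : z ^ 2 * Real.exp (-(|z| / 2)) ≤ hker z := by
  rcases eq_or_ne z 0 with rfl | hz
  · simp [hker_zero]
  have hz' : 0 < |z| := abs_pos.mpr hz
  rw [← hker_abs, hker_of_pos hz', sq_abs, Real.exp_neg, ← div_eq_mul_inv]
  have h1 : 0 < Real.sinh (|z| / 2) := Real.sinh_pos_iff.mpr (by positivity)
  refine div_le_div_of_nonneg_left (sq_nonneg _) (by positivity) ?_
  rw [Real.sinh_eq]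
  linarith [Real.exp_pos (-(|z| / 2))]

lemma hker_nonneg (z : ℝ) : 0 ≤ hker z := le_trans (by positivity) (le_hker z)

lemma hker_pos {z : ℝ} (hz : z ≠ 0) : 0 < hker z := lt_of_lt_of_le (by positivity) (le_hker z)

lemma hker_le (z : ℝ) : hker z ≤ 2 * |z| * Real.exp (-(|z| / 4)) := by
  rcases eq_or_ne z 0 with rfl | hz
  · simp [hker_zero]
  have hz' : 0 < |z| := abs_pos.mpr hz
  rw [← hker_abs, hker_of_pos hz']
  set r := |z|
  -- The `sinh` factor cancels one power of `r` near the origin; the `cosh` factor provides the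
  -- exponential decay.
  have h1 : Real.sinh (r / 2) = 2 * Real.sinh (r / 4) * Real.cosh (r / 4) := by
    rw [← Real.sinh_two_mul]; congr 1; ring
  have h2 : r / 4 ≤ Real.sinh (r / 4) := Real.self_le_sinh_iff.mpr (by positivity)
  have h3 : Real.exp (r / 4) / 2 ≤ Real.cosh (r / 4) := by
    rw [Real.cosh_eq]; linarith [Real.exp_pos (-(r / 4))]
  have h4 : r / 2 * Real.exp (r / 4) ≤ 2 * Real.sinh (r / 2) := by
    rw [h1]
    have := mul_le_mul h2 h3 (by positivity) (le_trans (by positivity) h2)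
    nlinarith
  have hE := Real.exp_pos (r / 4)
  rw [Real.exp_neg]
  calc r ^ 2 / (2 * Real.sinh (r / 2)) ≤ r ^ 2 / (r / 2 * Real.exp (r / 4)) :=
        div_le_div_of_nonneg_left (sq_nonneg _) (by positivity) h4
    _ = 2 * r * (Real.exp (r / 4))⁻¹ := by field_simp

lemma measurable_sign : Measurable Real.sign := by
  unfold Real.sign
  exact Measurable.ite measurableSet_Iio measurable_const
    (Measurable.ite measurableSet_Ioi measurable_const measurable_const)

lemma measurable_hker : Measurable hker := by
  unfold hker
  have := measurable_sign
  fun_prop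

/-- Factorization of the dimensionless kernel. -/
lemma kbar₀_eq (x y : ℝ) : kbar₀ x (y - x) = hker (y - x) * ch x / ch y := by
  -- On the diagonal `n₀ 0` is a division by zero, but the factors `y²` and `sgn y` make both sides
  -- vanish.
  rcases eq_or_ne (y - x) 0 with hz | hz
  · simp [kbar₀, hz, hker_zero]
  unfold kbar₀ hker ch n₀ f₀
  rw [sub_add_cancel]
  have hs : Real.sinh ((y - x) / 2) ≠ 0 := by
    rw [Ne, Real.sinh_eq_zero]; intro h; exact hz (by linarith)
  have hsn : Real.exp (y - x) - 1 ≠ 0 := by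
    rw [sub_ne_zero, Ne, Real.exp_eq_one_iff]; exact hz
  have hy : Real.exp y + 1 ≠ 0 := by positivity
  have hc := (Real.cosh_pos (y / 2)).ne'
  suffices h : 1 / (Real.exp (y - x) - 1) + 1 / (Real.exp y + 1) =
      Real.cosh (x / 2) / (2 * Real.sinh ((y - x) / 2) * Real.cosh (y / 2)) by
    rw [h]; field_simp
  have e1 : Real.exp (y - x) - 1 = Real.exp ((y - x) / 2) * (2 * Real.sinh ((y - x) / 2)) := by
    rw [Real.sinh_eq]
    have : Real.exp (y - x) = Real.exp ((y - x) / 2) * Real.exp ((y - x) / 2) := by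
      rw [← Real.exp_add]; congr 1; ring
    have h1 : Real.exp ((y - x) / 2) * Real.exp (-((y - x) / 2)) = 1 := by
      rw [← Real.exp_add]; simp
    rw [this]; linear_combination h1
  have e2 : Real.exp y + 1 = Real.exp (y / 2) * (2 * Real.cosh (y / 2)) := by
    rw [Real.cosh_eq]
    have : Real.exp y = Real.exp (y / 2) * Real.exp (y / 2) := by
      rw [← Real.exp_add]; congr 1; ring
    have h1 : Real.exp (y / 2) * Real.exp (-(y / 2)) = 1 := by
      rw [← Real.exp_add]; simp
    rw [this]; linear_combination -h1
  rw [e1, e2]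
  have hA := Real.exp_pos ((y - x) / 2)
  have hB := Real.exp_pos (y / 2)
  field_simp
  have hx : x / 2 = y / 2 - (y - x) / 2 := by ring
  rw [hx]
  generalize y / 2 = b
  generalize (y - x) / 2 = a
  rw [Real.cosh_sub, Real.cosh_eq, Real.sinh_eq, Real.cosh_eq, Real.sinh_eq, Real.exp_neg,
    Real.exp_neg]
  have := Real.exp_pos a
  have := Real.exp_pos b
  field_simp
  ring

lemma w_eq {T : ℝ} (ε : ℝ) : w T ε = 1 / (4 * ch (ε / T) ^ 2) := by
  unfold w f₀ ch
  generalize ε / T = x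
  have e2 : Real.exp x + 1 = Real.exp (x / 2) * (2 * Real.cosh (x / 2)) := by
    rw [Real.cosh_eq]
    have : Real.exp x = Real.exp (x / 2) * Real.exp (x / 2) := by
      rw [← Real.exp_add]; congr 1; ring
    have h1 : Real.exp (x / 2) * Real.exp (-(x / 2)) = 1 := by
      rw [← Real.exp_add]; simp
    rw [this]; linear_combination -h1
  have h1 : 1 - 1 / (Real.exp x + 1) = Real.exp x / (Real.exp x + 1) := by
    field_simp; ring
  have : Real.exp x = Real.exp (x / 2) * Real.exp (x / 2) := by
    rw [← Real.exp_add]; congr 1; ring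
  rw [h1, e2, this]
  have := Real.cosh_pos (x / 2)
  have := Real.exp_pos (x / 2)
  field_simp
  norm_num

lemma integrable_exp_neg_mul_abs {c : ℝ} (hc : 0 < c) :
    Integrable (fun x : ℝ => Real.exp (-(c * |x|))) := by
  rw [← integrableOn_univ, ← Set.Iic_union_Ioi (a := (0 : ℝ))]
  refine IntegrableOn.union ?_ ?_
  · refine (integrableOn_exp_mul_Iic hc 0).congr_fun (fun x hx => ?_) measurableSet_Iic
    simp only [Set.mem_Iic] at hx
    simp [abs_of_nonpos hx]
  · refine (integrableOn_exp_mul_Ioi (neg_lt_zero.mpr hc) 0).congr_fun (fun x hx => ?_)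
      measurableSet_Ioi
    simp only [Set.mem_Ioi] at hx
    simp [abs_of_pos hx]

lemma integrable_abs_pow_mul_exp {c : ℝ} (hc : 0 < c) (n : ℕ) :
    Integrable (fun x : ℝ => |x| ^ n * Real.exp (-(c * |x|))) := by
  refine ((integrable_exp_neg_mul_abs (half_pos hc)).const_mul
    (n.factorial * (2 / c) ^ n)).mono' (by fun_prop) (Eventually.of_forall fun x => ?_)
  rw [Real.norm_of_nonneg (by positivity)]
  -- Half of the exponential pays for the power, the other half remains as an integrable majorant.
  have h1 := Real.pow_div_factorial_le_exp (c / 2 * |x|) (by positivity) n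
  rw [div_le_iff₀ (by positivity)] at h1
  have h2 : Real.exp (-(c * |x|)) =
      Real.exp (-(c / 2 * |x|)) * Real.exp (-(c / 2 * |x|)) := by
    rw [← Real.exp_add]; congr 1; ring
  have h3 : Real.exp (c / 2 * |x|) * Real.exp (-(c / 2 * |x|)) = 1 := by
    rw [← Real.exp_add]; simp
  have h4 : |x| ^ n = (2 / c) ^ n * (c / 2 * |x|) ^ n := by
    rw [← mul_pow]; congr 1; field_simp
  rw [h2, h4]
  calc (2 / c) ^ n * (c / 2 * |x|) ^ n * (Real.exp (-(c / 2 * |x|)) * Real.exp (-(c / 2 * |x|)))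
      ≤ (2 / c) ^ n * (Real.exp (c / 2 * |x|) * n.factorial) *
        (Real.exp (-(c / 2 * |x|)) * Real.exp (-(c / 2 * |x|))) := by gcongr
    _ = n.factorial * (2 / c) ^ n * (Real.exp (c / 2 * |x|) * Real.exp (-(c / 2 * |x|))) *
        Real.exp (-(c / 2 * |x|)) := by ring
    _ = _ := by rw [h3, mul_one]

/-- A dominating function for `|z|^i hker z`. -/
def hbound (i : ℕ) (z : ℝ) : ℝ := 2 * (|z| ^ (i + 1) * Real.exp (-(1 / 4 * |z|)))

lemma abs_pow_mul_hker_le (i : ℕ) (z : ℝ) : |z ^ i * hker z| ≤ hbound i z := by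
  rw [abs_mul, abs_pow, abs_of_nonneg (hker_nonneg z), hbound]
  calc |z| ^ i * hker z ≤ |z| ^ i * (2 * |z| * Real.exp (-(|z| / 4))) := by
        gcongr; exact hker_le z
    _ = _ := by rw [show |z| / 4 = 1 / 4 * |z| by ring]; ring

lemma integrable_hbound (i : ℕ) : Integrable (hbound i) :=
  (integrable_abs_pow_mul_exp (by norm_num) _).const_mul 2

lemma memLp_hbound (i : ℕ) : MemLp (hbound i) 2 volume := by
  rw [memLp_two_iff_integrable_sq (integrable_hbound i).aestronglyMeasurable]
  refine ((integrable_abs_pow_mul_exp (c := 1 / 2) (by norm_num) (2 * (i + 1))).const_mul 4).congr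
    (Eventually.of_forall fun z => ?_)
  have : Real.exp (-(1 / 2 * |z|)) = Real.exp (-(1 / 4 * |z|)) * Real.exp (-(1 / 4 * |z|)) := by
    rw [← Real.exp_add]; congr 1; ring
  simp only [hbound, this]
  ring

lemma hbound_neg (i : ℕ) (z : ℝ) : hbound i (-z) = hbound i z := by simp [hbound]

lemma hbound_nonneg (i : ℕ) (z : ℝ) : 0 ≤ hbound i z := by unfold hbound; positivity

lemma integrable_hker : Integrable hker :=
  (integrable_hbound 0).mono' measurable_hker.aestronglyMeasurable
    (Eventually.of_forall fun z => by simpa using abs_pow_mul_hker_le 0 z)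

lemma integrable_pow_mul_kbar₀ (i : ℕ) (x : ℝ) :
    Integrable (fun y => (y - x) ^ i * kbar₀ x (y - x)) := by
  have h0 : Integrable (fun y => hbound i (y - x) * ch x) :=
    ((integrable_hbound i).comp_sub_right x).mul_const _
  refine h0.mono' ?_ (Eventually.of_forall fun y => ?_)
  · simp only [kbar₀_eq]
    have := measurable_hker
    have := continuous_ch.measurable
    exact Measurable.aestronglyMeasurable (by fun_prop)
  · rw [kbar₀_eq]
    have h1 : (y - x) ^ i * (hker (y - x) * ch x / ch y) =
        (y - x) ^ i * hker (y - x) * (ch x / ch y) := by ring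
    rw [h1, norm_mul, Real.norm_eq_abs, Real.norm_of_nonneg (div_pos (ch_pos x) (ch_pos y)).le]
    exact mul_le_mul (abs_pow_mul_hker_le i _) (div_le_self (ch_pos x).le (one_le_ch y))
      (div_pos (ch_pos x) (ch_pos y)).le (hbound_nonneg _ _)

lemma integrable_kbar₀ (x : ℝ) : Integrable (fun y => kbar₀ x (y - x)) := by
  simpa using integrable_pow_mul_kbar₀ 0 x

/-- Dimensionless single-particle relaxation rate. -/
def γ₀ (x : ℝ) : ℝ := ∫ y, kbar₀ x (y - x)

lemma measurable_kbar₀_uncurry : Measurable (fun p : ℝ × ℝ => kbar₀ p.1 (p.2 - p.1)) := by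
  simp only [kbar₀_eq]
  have := measurable_hker
  have := continuous_ch.measurable
  fun_prop

lemma measurable_γ₀ : Measurable γ₀ := by
  have := measurable_kbar₀_uncurry.stronglyMeasurable.integral_prod_right' (ν := volume)
  exact this.measurable

lemma γ₀_le (x : ℝ) : γ₀ x ≤ (∫ z, hker z) * ch x := by
  have h1 : ∫ y, hker (y - x) * ch x = (∫ z, hker z) * ch x := by
    rw [integral_mul_const, integral_sub_right_eq_self hker x]
  rw [← h1]
  refine integral_mono (integrable_kbar₀ x)
    ((integrable_hker.comp_sub_right x).mul_const _) fun y => ?_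
  simp only
  rw [kbar₀_eq]
  exact div_le_self (mul_nonneg (hker_nonneg _) (ch_pos x).le) (one_le_ch y)

lemma le_kbar₀ (x y : ℝ) :
    (y - x) ^ 2 / 2 * Real.exp ((|x| - |y| - |y - x|) / 2) ≤ kbar₀ x (y - x) := by
  rw [kbar₀_eq, mul_div_assoc]
  have h1 := le_hker (y - x)
  have h2 : Real.exp (|x| / 2) / 2 / Real.exp (|y| / 2) ≤ ch x / ch y :=
    div_le_div₀ (ch_pos x).le (exp_le_ch x) (ch_pos y) (ch_le_exp y)
  refine le_trans (le_of_eq ?_) (mul_le_mul h1 h2 (by positivity) (hker_nonneg _))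
  have : (|x| - |y| - |y - x|) / 2 = -(|y - x| / 2) + |x| / 2 - |y| / 2 := by ring
  rw [this, Real.exp_sub, Real.exp_add]
  ring

lemma kbar₀_nonneg (x y : ℝ) : 0 ≤ kbar₀ x (y - x) := le_trans (by positivity) (le_kbar₀ x y)

/-- A uniform lower bound for the relaxation rate. -/
def γmin : ℝ := ∫ z : ℝ, z ^ 2 / 2 * Real.exp (-|z|)

lemma integrable_γmin : Integrable (fun z : ℝ => z ^ 2 / 2 * Real.exp (-|z|)) := by
  refine ((integrable_abs_pow_mul_exp one_pos 2).div_const 2).congr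
    (Eventually.of_forall fun z => ?_)
  simp only [sq_abs, one_mul]; ring

lemma γmin_pos : 0 < γmin := by
  rw [γmin, integral_pos_iff_support_of_nonneg (fun z => by positivity) integrable_γmin]
  have : Set.Ioi (0 : ℝ) ⊆ Function.support (fun z : ℝ => z ^ 2 / 2 * Real.exp (-|z|)) := by
    intro z hz
    have hz : 0 < z := hz
    exact (by positivity : 0 < z ^ 2 / 2 * Real.exp (-|z|)).ne'
  exact lt_of_lt_of_le (by simp) (measure_mono this)

/-- By the reverse triangle inequality the exponent in `le_kbar₀` is at least `-|y - x|`, which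
leaves a translation-invariant minorant. -/
lemma γmin_le (x : ℝ) : γmin ≤ γ₀ x := by
  rw [γmin, ← integral_sub_right_eq_self _ x]
  refine integral_mono (integrable_γmin.comp_sub_right x) (integrable_kbar₀ x) fun y => ?_
  refine le_trans ?_ (le_kbar₀ x y)
  have h : |y| - |x| ≤ |y - x| := abs_sub_abs_le_abs_sub y x
  gcongr
  linarith

lemma γ₀_pos (x : ℝ) : 0 < γ₀ x := γmin_pos.trans_le (γmin_le x)

lemma kbar₀_neg (x y : ℝ) : kbar₀ (-x) (-y - -x) = kbar₀ x (y - x) := by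
  rw [kbar₀_eq, kbar₀_eq, ch_neg, ch_neg, ← hker_neg]
  congr 3; ring

lemma γ₀_neg (x : ℝ) : γ₀ (-x) = γ₀ x := by
  unfold γ₀
  rw [← integral_neg_eq_self (fun y => kbar₀ (-x) (y - -x)) volume]
  simp only [kbar₀_neg]

/-- For `0 ≤ y ≤ x` the exponent in `le_kbar₀` vanishes and the quadratic integrates to `x³ / 6`;
negative `x` follows by reflection. This growth makes the symmetrized kernel small far out. -/
lemma cube_le_γ₀ (x : ℝ) : |x| ^ 3 / 6 ≤ γ₀ x := by
  have key : ∀ x : ℝ, 0 ≤ x → x ^ 3 / 6 ≤ γ₀ x := by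
    intro x hx
    have h1 : ∫ y in (0 : ℝ)..x, (y - x) ^ 2 / 2 = x ^ 3 / 6 := by
      have := intervalIntegral.integral_comp_sub_right (a := 0) (b := x)
        (fun z : ℝ => z ^ 2 / 2) x
      rw [this, intervalIntegral.integral_div, integral_pow]
      norm_num; ring
    rw [← h1, intervalIntegral.integral_of_le hx]
    refine le_trans ?_ (setIntegral_le_integral (integrable_kbar₀ x)
      (Eventually.of_forall fun y => kbar₀_nonneg x y) (s := Set.Ioc 0 x))
    refine setIntegral_mono_on ?_ (integrable_kbar₀ x).integrableOn measurableSet_Ioc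
      fun y hy => ?_
    · exact (Continuous.integrableOn_Icc (by fun_prop)).mono_set Set.Ioc_subset_Icc_self
    · refine le_trans (le_of_eq ?_) (le_kbar₀ x y)
      rw [abs_of_nonneg hx, abs_of_pos hy.1, abs_of_nonpos (by linarith [hy.2])]
      simp
  rcases le_total 0 x with hx | hx
  · rw [abs_of_nonneg hx]; exact key x hx
  · rw [abs_of_nonpos hx, ← γ₀_neg]; exact key (-x) (by linarith)

end Bloch

end

/-! ### Symmetrized operators on `L²(dx)` -/

noncomputable section

namespace Bloch

/-- Square root of the relaxation rate. -/
def sγ (x : ℝ) : ℝ := √(γ₀ x)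

lemma sγ_pos (x : ℝ) : 0 < sγ x := Real.sqrt_pos.mpr (γ₀_pos x)

lemma sγ_sq (x : ℝ) : sγ x ^ 2 = γ₀ x := Real.sq_sqrt (γ₀_pos x).le

lemma measurable_sγ : Measurable sγ := measurable_γ₀.sqrt

/-- Symmetrized kernels on `L²(dx)`. -/
def Nker (i : ℕ) (x y : ℝ) : ℝ := (y - x) ^ i * hker (y - x) / (sγ x * sγ y)

/-- Square root of the density of `σ`, the image of the constant function. -/
def evec (x : ℝ) : ℝ := sγ x / (2 * ch x)

/-- The image of the source term. -/
def bvec (x : ℝ) : ℝ := 1 / (2 * ch x * sγ x)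

lemma evec_pos (x : ℝ) : 0 < evec x := div_pos (sγ_pos x) (by linarith [ch_pos x])

lemma measurable_evec : Measurable evec := by
  unfold evec
  have := measurable_sγ
  have := continuous_ch.measurable
  fun_prop

lemma measurable_bvec : Measurable bvec := by
  unfold bvec
  have := measurable_sγ
  have := continuous_ch.measurable
  fun_prop

lemma measurable_Nker (i : ℕ) : Measurable (Function.uncurry (Nker i)) := by
  unfold Nker Function.uncurry
  have := measurable_sγ
  have := measurable_hker
  fun_prop

lemma Nker_swap (i : ℕ) (x y : ℝ) : Nker i y x = (-1) ^ i * Nker i x y := by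
  unfold Nker
  rw [show x - y = -(y - x) by ring, hker_neg, neg_pow]
  ring

lemma Nker_mul_evec (i : ℕ) (x y : ℝ) :
    Nker i x y * evec y = (y - x) ^ i * kbar₀ x (y - x) * (evec x / γ₀ x) := by
  have h1 := ch_pos x
  have h2 := ch_pos y
  have h3 := sγ_pos x
  have h4 := sγ_pos y
  rw [kbar₀_eq, ← sγ_sq]
  unfold Nker evec
  field_simp

/-- The constant `c` is left free for two uses: `c = γmin` bounds the kernel everywhere, and a large
`c` bounds it where `γ₀ y` is large. -/
lemma abs_Nker_le_of_le (i : ℕ) {x y c : ℝ} (hc : 0 < c) (h : c ^ 2 ≤ γmin * γ₀ y) :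
    |Nker i x y| ≤ hbound i (x - y) / c := by
  unfold Nker
  have hpos : 0 < sγ x * sγ y := mul_pos (sγ_pos x) (sγ_pos y)
  rw [abs_div, abs_of_pos hpos]
  have h1 : c ≤ sγ x * sγ y := by
    refine abs_le_of_sq_le_sq' ?_ hpos.le |>.2
    rw [mul_pow, sγ_sq, sγ_sq]
    exact h.trans (mul_le_mul_of_nonneg_right (γmin_le x) (γ₀_pos y).le)
  have h2 := abs_pow_mul_hker_le i (y - x)
  rw [← hbound_neg, neg_sub] at h2
  exact div_le_div₀ (hbound_nonneg _ _) h2 hc h1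

lemma kernelDominated (i : ℕ) : KernelDominated (Nker i) (fun z => hbound i z / γmin) where
  measurable := measurable_Nker i
  bound x y := abs_Nker_le_of_le i γmin_pos (by
    rw [sq]; exact mul_le_mul_of_nonneg_left (γmin_le y) γmin_pos.le)
  integrable := (integrable_hbound i).div_const _
  memLp := by
    simp only [div_eq_mul_inv]
    exact (memLp_hbound i).mul_const _
  even z := by rw [hbound_neg]

lemma integrable_inv_ch : Integrable (fun x => 1 / ch x) := by
  refine ((integrable_exp_neg_mul_abs (c := 1 / 2) (by norm_num)).const_mul 2).mono'
    ?_ (Eventually.of_forall fun x => ?_)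
  · have := continuous_ch.measurable
    exact Measurable.aestronglyMeasurable (by fun_prop)
  · rw [Real.norm_of_nonneg (by have := ch_pos x; positivity), Real.exp_neg, div_le_iff₀ (ch_pos x)]
    have h := exp_le_ch x
    rw [show |x| / 2 = 1 / 2 * |x| by ring] at h
    have hE := Real.exp_pos (1 / 2 * |x|)
    calc (1 : ℝ) = 2 * (Real.exp (1 / 2 * |x|))⁻¹ * (Real.exp (1 / 2 * |x|) / 2) := by
          field_simp
      _ ≤ _ := by gcongr

lemma evec_sq (x : ℝ) : evec x ^ 2 = 1 / (4 * ch x ^ 2) * γ₀ x := by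
  rw [evec, div_pow, sγ_sq]; ring

lemma memLp_evec : MemLp evec 2 volume := by
  rw [memLp_two_iff_integrable_sq measurable_evec.aestronglyMeasurable]
  refine (integrable_inv_ch.const_mul (∫ z, hker z)).mono'
    (measurable_evec.pow_const 2).aestronglyMeasurable (Eventually.of_forall fun x => ?_)
  rw [Real.norm_of_nonneg (sq_nonneg _), evec_sq]
  have h := ch_pos x
  have hI : 0 ≤ ∫ z, hker z := integral_nonneg hker_nonneg
  calc 1 / (4 * ch x ^ 2) * γ₀ x ≤ 1 / (4 * ch x ^ 2) * ((∫ z, hker z) * ch x) := by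
        gcongr; exact γ₀_le x
    _ = (∫ z, hker z) * (1 / ch x) * (1 / 4) := by field_simp
    _ ≤ (∫ z, hker z) * (1 / ch x) * 1 := by gcongr; norm_num
    _ = _ := mul_one _

lemma memLp_bvec : MemLp bvec 2 volume := by
  rw [memLp_two_iff_integrable_sq measurable_bvec.aestronglyMeasurable]
  refine (integrable_inv_ch.const_mul (1 / γmin)).mono'
    (measurable_bvec.pow_const 2).aestronglyMeasurable (Eventually.of_forall fun x => ?_)
  rw [Real.norm_of_nonneg (sq_nonneg _), bvec, div_pow, mul_pow, sγ_sq, one_pow]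
  have h := one_le_ch x
  have hm := γmin_pos
  rw [one_div_mul_one_div]
  refine one_div_le_one_div_of_le (by positivity) ?_
  rw [mul_comm]
  refine mul_le_mul ?_ (γmin_le x) hm.le (by positivity)
  nlinarith

lemma intOp_Nker_evec (i : ℕ) (x : ℝ) :
    intOp (Nker i) evec x = (∫ y, (y - x) ^ i * kbar₀ x (y - x)) * (evec x / γ₀ x) := by
  simp only [intOp, Nker_mul_evec, integral_mul_const]

/-- After conjugation this is `K₀ 1 = 1`, which holds because `γ₀` is the normalizing integral of
the kernel. -/
lemma intOp_Nker_zero_evec : intOp (Nker 0) evec = evec := by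
  ext x
  rw [intOp_Nker_evec]
  simp only [pow_zero, one_mul]
  have := γ₀_pos x
  change γ₀ x * _ = _
  field_simp

lemma evec_mul_bvec (x : ℝ) : evec x * bvec x = 1 / (4 * ch x ^ 2) := by
  have h1 := ch_pos x
  have h2 := sγ_pos x
  unfold evec bvec
  field_simp
  norm_num

lemma integral_weight : ∫ x, 1 / (4 * ch x ^ 2) = 1 := by
  -- The weight is the derivative of `-f₀`, which increases from `-1` to `0`.
  have hd : ∀ x : ℝ, HasDerivAt (fun x => -(Real.exp x + 1)⁻¹) (1 / (4 * ch x ^ 2)) x := by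
    intro x
    have hne : Real.exp x + 1 ≠ 0 := by positivity
    have h2 := (((Real.hasDerivAt_exp x).add_const 1).inv hne).neg
    refine h2.congr_deriv ?_
    have h3 := w_eq (T := 1) x
    rw [div_one] at h3
    rw [← h3, w, f₀, div_one]
    field_simp
    ring
  have hInt : Integrable (fun x => 1 / (4 * ch x ^ 2)) := by
    have := memLp_evec.integrable_mul memLp_bvec
    exact this.congr (Eventually.of_forall fun x => evec_mul_bvec x)
  have hlim : Tendsto (fun x => -(Real.exp x + 1)⁻¹) atTop (𝓝 (-0)) :=
    (tendsto_inv_atTop_zero.comp (tendsto_atTop_add_const_right _ 1 Real.tendsto_exp_atTop)).neg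
  have hlim' : Tendsto (fun x => -(Real.exp x + 1)⁻¹) atBot (𝓝 (-(0 + 1)⁻¹)) :=
    ((Real.tendsto_exp_atBot.add_const 1).inv₀ (by norm_num)).neg
  rw [integral_of_hasDerivAt_of_tendsto hd hInt hlim' hlim]
  norm_num

/-- The operator on `L²` with kernel `Nker i`. -/
def Mop (i : ℕ) : Lp ℝ 2 (volume : Measure ℝ) →L[ℝ] Lp ℝ 2 (volume : Measure ℝ) :=
  (kernelDominated i).opL

/-- The function `evec` as an element of `L²`. -/
def eL : Lp ℝ 2 (volume : Measure ℝ) := memLp_evec.toLp evec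

/-- The function `bvec` as an element of `L²`. -/
def bL : Lp ℝ 2 (volume : Measure ℝ) := memLp_bvec.toLp bvec

lemma inner_eL_bL : ⟪eL, bL⟫ = 1 := by
  rw [eL, bL, inner_toLp_toLp]
  simp only [evec_mul_bvec]
  exact integral_weight

lemma inner_Mop (i : ℕ) (F G : Lp ℝ 2 (volume : Measure ℝ)) :
    ⟪Mop i F, G⟫ = (-1) ^ i * ⟪F, Mop i G⟫ :=
  (kernelDominated i).inner_opL_swap (Nker_swap i) F G

lemma Mop_toLp (i : ℕ) {F : ℝ → ℝ} (hF : MemLp F 2 volume) :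
    Mop i (hF.toLp F) = ((kernelDominated i).memLp_intOp hF).toLp (intOp (Nker i) F) :=
  (kernelDominated i).opL_toLp hF

lemma Mop_zero_eL : Mop 0 eL = eL := by
  rw [eL, Mop_toLp]
  congr 1
  exact intOp_Nker_zero_evec

lemma eL_ne_zero : eL ≠ 0 := by
  intro h
  have := inner_eL_bL
  rw [h, inner_zero_left] at this
  exact zero_ne_one this

lemma intOp_Nker_two_evec_pos (x : ℝ) : 0 < intOp (Nker 2) evec x := by
  rw [intOp_Nker_evec]
  refine mul_pos ?_ (div_pos (evec_pos x) (γ₀_pos x))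
  rw [integral_pos_iff_support_of_nonneg
    (fun y => mul_nonneg (sq_nonneg _) (kbar₀_nonneg x y)) (integrable_pow_mul_kbar₀ 2 x)]
  have : Set.Ioi x ⊆ Function.support (fun y => (y - x) ^ 2 * kbar₀ x (y - x)) := by
    intro y hy
    have hy : 0 < y - x := sub_pos.mpr hy
    have : 0 < kbar₀ x (y - x) := lt_of_lt_of_le (by positivity) (le_kbar₀ x y)
    exact (by positivity : 0 < (y - x) ^ 2 * kbar₀ x (y - x)).ne'
  exact lt_of_lt_of_le (by simp) (measure_mono this)

lemma inner_eL_Mop_eL (i : ℕ) : ⟪eL, Mop i eL⟫ = ∫ x, evec x * intOp (Nker i) evec x := by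
  rw [eL, Mop_toLp, inner_toLp_toLp]

lemma inner_eL_Mop_two_pos : 0 < ⟪eL, Mop 2 eL⟫ := by
  rw [inner_eL_Mop_eL]
  have hpos : ∀ x, 0 < evec x * intOp (Nker 2) evec x := fun x =>
    mul_pos (evec_pos x) (intOp_Nker_two_evec_pos x)
  rw [integral_pos_iff_support_of_nonneg (fun x => (hpos x).le)
    (memLp_evec.integrable_mul ((kernelDominated 2).memLp_intOp memLp_evec))]
  have : Function.support (fun x => evec x * intOp (Nker 2) evec x) = Set.univ :=
    Set.eq_univ_of_forall fun x => (hpos x).ne'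
  rw [this]; simp

end Bloch

end

/-! ### Spectral gap of the symmetrized collision operator -/

noncomputable section

namespace Bloch

variable {F : ℝ → ℝ}

lemma Nker_zero_nonneg (x y : ℝ) : 0 ≤ Nker 0 x y := by
  unfold Nker
  have := hker_nonneg (y - x)
  have := sγ_pos x
  have := sγ_pos y
  positivity

lemma Nker_zero_symm (x y : ℝ) : Nker 0 y x = Nker 0 x y := by
  rw [Nker_swap]; simp

lemma integral_Nker_zero_mul_evec (x : ℝ) : ∫ y, Nker 0 x y * evec y = evec x :=
  congrFun intOp_Nker_zero_evec x

lemma integrable_deficit (hF : MemLp F 2 volume) :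
    Integrable (fun p : ℝ × ℝ => evec p.1 * (Nker 0 p.1 p.2 * evec p.2 * (F p.2 / evec p.2) ^ 2))
      (volume.prod volume) := by
  have hmeas : AEStronglyMeasurable
      (fun p : ℝ × ℝ => evec p.1 * (Nker 0 p.1 p.2 * evec p.2 * (F p.2 / evec p.2) ^ 2))
      (volume.prod volume) := by
    have h1 : AEStronglyMeasurable (fun p : ℝ × ℝ => F p.2) (volume.prod volume) :=
      hF.aestronglyMeasurable.comp_snd
    have h2 : AEStronglyMeasurable (fun p : ℝ × ℝ => evec p.2) (volume.prod volume) :=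
      (measurable_evec.comp measurable_snd).aestronglyMeasurable
    have h3 : AEStronglyMeasurable (fun p : ℝ × ℝ => evec p.1) (volume.prod volume) :=
      (measurable_evec.comp measurable_fst).aestronglyMeasurable
    exact h3.mul (((measurable_Nker 0).aestronglyMeasurable.mul h2).mul
      ((h1.aemeasurable.div h2.aemeasurable).aestronglyMeasurable.pow 2))
  have hpt : ∀ x y, evec x * (Nker 0 x y * evec y * (F y / evec y) ^ 2) =
      Nker 0 y x * evec x * (F y ^ 2 / evec y) := by
    intro x y
    have := evec_pos y
    rw [Nker_zero_symm]
    field_simp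
  have hpos : ∀ x y, 0 ≤ evec x * (Nker 0 x y * evec y * (F y / evec y) ^ 2) := fun x y =>
    mul_nonneg (evec_pos x).le (mul_nonneg (mul_nonneg (Nker_zero_nonneg x y) (evec_pos y).le)
      (sq_nonneg _))
  rw [integrable_prod_iff' hmeas]
  constructor
  · refine Eventually.of_forall fun y => ?_
    simp only [hpt]
    exact ((kernelDominated 0).integrable_section memLp_evec y).mul_const _
  · refine hF.integrable_sq.congr (Eventually.of_forall fun y => ?_)
    simp only [fun x => Real.norm_of_nonneg (hpos x y)]
    simp only [hpt]
    rw [integral_mul_const, integral_Nker_zero_mul_evec]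
    have := evec_pos y
    field_simp

/-- Stationarity of `evec²` for the Markov kernel `Nker 0 x y * evec y / evec x`: integrating first
in `x`, symmetry and `intOp_Nker_zero_evec` remove the kernel. -/
lemma integral_deficit (hF : MemLp F 2 volume) :
    ∫ x, ∫ y, evec x * (Nker 0 x y * evec y * (F y / evec y) ^ 2) = ∫ x, F x ^ 2 := by
  rw [integral_integral_swap (integrable_deficit hF)]
  congr 1; ext y
  have hpt : ∀ x, evec x * (Nker 0 x y * evec y * (F y / evec y) ^ 2) =
      Nker 0 y x * evec x * (F y ^ 2 / evec y) := by
    intro x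
    have := evec_pos y
    rw [Nker_zero_symm]
    field_simp
  simp only [hpt]
  rw [integral_mul_const, integral_Nker_zero_mul_evec]
  have := evec_pos y
  field_simp

/-- Local variance of `F / evec` under the Markov kernel started at `x`. -/
def localVar (F : ℝ → ℝ) (x : ℝ) : ℝ :=
  evec x * ∫ y, Nker 0 x y * evec y * (F y / evec y - intOp (Nker 0) F x / evec x) ^ 2

lemma localVar_nonneg (F : ℝ → ℝ) (x : ℝ) : 0 ≤ localVar F x :=
  mul_nonneg (evec_pos x).le (integral_nonneg fun y =>
    mul_nonneg (mul_nonneg (Nker_zero_nonneg x y) (evec_pos y).le) (sq_nonneg _))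

lemma localVar_ae (hF : MemLp F 2 volume) :
    ∀ᵐ x, Integrable (fun y => Nker 0 x y * evec y *
        (F y / evec y - intOp (Nker 0) F x / evec x) ^ 2) ∧
      localVar F x = (∫ y, evec x * (Nker 0 x y * evec y * (F y / evec y) ^ 2)) -
        intOp (Nker 0) F x ^ 2 := by
  filter_upwards [(integrable_deficit hF).prod_right_ae] with x hx
  have he := evec_pos x
  have hx' : Integrable (fun y => Nker 0 x y * evec y * (F y / evec y) ^ 2) := by
    refine (hx.const_mul (1 / evec x)).congr (Eventually.of_forall fun y => ?_)
    simp only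
    field_simp
  have hkf : (fun y => Nker 0 x y * evec y * (F y / evec y)) = fun y => Nker 0 x y * F y := by
    ext y
    have := evec_pos y
    field_simp
  have h := integral_mul_sub_sq (f := fun y => F y / evec y)
    ((kernelDominated 0).integrable_section memLp_evec x)
    (by rw [hkf]; exact (kernelDominated 0).integrable_section hF x) hx'
    (intOp (Nker 0) F x / evec x)
  refine ⟨h.1, ?_⟩
  rw [localVar, h.2, hkf, integral_Nker_zero_mul_evec, integral_const_mul]
  change _ * (_ - _ * intOp (Nker 0) F x + _) = _
  field_simp
  ring

/-- Law of total variance: the norm lost under `Mop 0` is the mean conditional variance of `F /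
evec` after one step of the chain. -/
lemma localVar_integral (hF : MemLp F 2 volume) :
    Integrable (localVar F) ∧
    ∫ x, localVar F x = (∫ x, F x ^ 2) - ∫ x, intOp (Nker 0) F x ^ 2 := by
  have hae : localVar F =ᵐ[volume] fun x =>
      (∫ y, evec x * (Nker 0 x y * evec y * (F y / evec y) ^ 2)) - intOp (Nker 0) F x ^ 2 := by
    filter_upwards [localVar_ae hF] with x hx using hx.2
  have h1 : Integrable (fun x => ∫ y, evec x * (Nker 0 x y * evec y * (F y / evec y) ^ 2)) :=
    (integrable_deficit hF).integral_prod_left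
  have h2 := ((kernelDominated 0).memLp_intOp hF).integrable_sq
  refine ⟨(h1.sub h2).congr hae.symm, ?_⟩
  rw [integral_congr_ae hae, integral_sub h1 h2, integral_deficit hF]

lemma integral_hker_pos : 0 < ∫ z, hker z := by
  have h := γ₀_le 0
  have h0 := γ₀_pos 0
  by_contra hneg
  have := mul_nonpos_of_nonpos_of_nonneg (not_lt.mp hneg) (ch_pos 0).le
  linarith

/-- Doeblin condition. Starting points are taken outside `[-R, R]` so that `1 ≤ |y - x| ≤ 2 R + 2`:
`hker` vanishes at the origin and would give no lower bound near the diagonal. -/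
lemma minorization {R x y : ℝ} (hx : x ∈ Set.Icc (R + 1) (R + 2)) (hy : y ∈ Set.Icc (-R) R) :
    Real.exp (-(R + 1)) / ((∫ z, hker z) * Real.exp ((R + 2) / 2)) * evec y ≤
      evec x * Nker 0 x y := by
  have hI := integral_hker_pos
  have hR : 0 ≤ R := by linarith [hy.1, hy.2]
  have h1 : Real.exp (-(R + 1)) ≤ hker (y - x) := by
    refine le_trans ?_ (le_hker _)
    rw [abs_of_nonpos (by linarith [hx.1, hy.2])]
    have h2 : 1 ≤ (y - x) ^ 2 := by nlinarith [hx.1, hy.2]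
    have h3 : Real.exp (-(R + 1)) ≤ Real.exp (-(-(y - x) / 2)) :=
      Real.exp_le_exp.mpr (by linarith [hx.2, hy.1])
    nlinarith [Real.exp_pos (-(R + 1))]
  have h2 : ch x ≤ Real.exp ((R + 2) / 2) := by
    refine (ch_le_exp x).trans (Real.exp_le_exp.mpr ?_)
    rw [abs_of_nonneg (by linarith [hx.1])]
    linarith [hx.2]
  have hcx := ch_pos x
  have hcy := ch_pos y
  have hsx := sγ_pos x
  have hsy := sγ_pos y
  have h3 : evec x * Nker 0 x y = hker (y - x) / (ch x) / (γ₀ y / ch y) * evec y := by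
    rw [← sγ_sq]
    unfold evec Nker
    field_simp
  rw [h3]
  refine mul_le_mul_of_nonneg_right ?_ (evec_pos y).le
  have h4 : γ₀ y / ch y ≤ ∫ z, hker z := by
    rw [div_le_iff₀ hcy]; exact γ₀_le y
  rw [div_div]
  refine div_le_div₀ (hker_nonneg _) h1 (mul_pos hcx (div_pos (γ₀_pos y) hcy)) ?_
  rw [mul_comm]
  exact mul_le_mul h4 h2 hcx.le hI.le

/-- Some starting point `x` in the unit interval `[R + 1, R + 2]` has local variance at most its
average there, hence at most the whole deficit. Minorization at this `x` compares its variance with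
the integral over `[-R, R]`, and `m` is the conditional mean. -/
lemma exists_local_poincare (R : ℝ) :
    ∃ c > 0, ∀ F : ℝ → ℝ, MemLp F 2 volume → ∃ m : ℝ,
      c * ∫ y in Set.Icc (-R) R, (F y - m * evec y) ^ 2 ≤
        (∫ x, F x ^ 2) - ∫ x, intOp (Nker 0) F x ^ 2 := by
  have hI := integral_hker_pos
  refine ⟨Real.exp (-(R + 1)) / ((∫ z, hker z) * Real.exp ((R + 2) / 2)), by positivity,
    fun F hF => ?_⟩
  set c := Real.exp (-(R + 1)) / ((∫ z, hker z) * Real.exp ((R + 2) / 2))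
  obtain ⟨hInt, heq⟩ := localVar_integral hF
  have hvol : volume (Set.Icc (R + 1) (R + 2)) = 1 := by
    rw [Real.volume_Icc]; norm_num
  have hmass := measure_le_setAverage_pos (f := localVar F) (by rw [hvol]; simp)
    (by rw [hvol]; simp) (hInt.integrableOn (s := Set.Icc (R + 1) (R + 2)))
  obtain ⟨x, hxN, hxS, hx⟩ := Frequently.exists
    ((frequently_ae_mem_iff.mpr hmass.ne').and_eventually (localVar_ae hF) |>.mono
      fun x h => (⟨h.2, h.1.1, h.1.2⟩ : _ ∧ x ∈ Set.Icc (R + 1) (R + 2) ∧ localVar F x ≤ _))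
  have hD : localVar F x ≤ ∫ x, localVar F x := by
    refine hx.trans ?_
    rw [setAverage_eq, Measure.real, hvol]
    simp only [ENNReal.toReal_one, inv_one, one_smul]
    exact setIntegral_le_integral hInt (Eventually.of_forall (localVar_nonneg F))
  rw [← heq]
  refine ⟨intOp (Nker 0) F x / evec x, le_trans ?_ hD⟩
  set m := intOp (Nker 0) F x / evec x with hm
  rw [localVar, ← integral_const_mul, ← integral_const_mul]
  have hpos : ∀ y, 0 ≤ evec x * (Nker 0 x y * evec y * (F y / evec y - m) ^ 2) := fun y =>
    mul_nonneg (evec_pos x).le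
      (mul_nonneg (mul_nonneg (Nker_zero_nonneg x y) (evec_pos y).le) (sq_nonneg _))
  refine le_trans ?_ (setIntegral_le_integral (s := Set.Icc (-R) R) (hxN.1.const_mul _)
    (Eventually.of_forall hpos))
  refine setIntegral_mono_on ?_ (hxN.1.const_mul _).integrableOn measurableSet_Icc
    fun y hy => ?_
  · exact ((hF.sub (memLp_evec.const_mul m)).integrable_sq.const_mul c).integrableOn
  · have he := evec_pos y
    have h := minorization hxS hy
    have h2 : evec x * (Nker 0 x y * evec y * (F y / evec y - m) ^ 2) =
        evec x * Nker 0 x y * ((F y - m * evec y) ^ 2 / evec y) := by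
      field_simp
    rw [h2]
    calc c * (F y - m * evec y) ^ 2 = c * evec y * ((F y - m * evec y) ^ 2 / evec y) := by
          field_simp
      _ ≤ _ := by gcongr

lemma norm_Mop_zero_sq (F : Lp ℝ 2 (volume : Measure ℝ)) :
    ‖Mop 0 F‖ ^ 2 = ∫ x, intOp (Nker 0) F x ^ 2 :=
  norm_toLp_sq ((kernelDominated 0).memLp_intOp (Lp.memLp F))

lemma norm_sq_eq (F : Lp ℝ 2 (volume : Measure ℝ)) : ‖F‖ ^ 2 = ∫ x, F x ^ 2 := by
  rw [← norm_toLp_sq (Lp.memLp F), Lp.toLp_coeFn]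

lemma norm_Mop_zero_le (F : Lp ℝ 2 (volume : Measure ℝ)) : ‖Mop 0 F‖ ≤ ‖F‖ := by
  refine abs_le_of_sq_le_sq' ?_ (norm_nonneg _) |>.2
  rw [norm_Mop_zero_sq, norm_sq_eq]
  have h := (localVar_integral (Lp.memLp F)).2
  have := integral_nonneg (μ := volume) (f := localVar F) (localVar_nonneg F)
  linarith

/-- Outside a large interval the operator `Mop 0` is small. -/
lemma exists_tail_bound : ∃ R : ℝ, ∀ F : ℝ → ℝ, ∀ hF : MemLp F 2 volume,
    ‖Mop 0 ((hF.indicator (measurableSet_Icc (a := -R) (b := R)).compl).toLp _)‖ ≤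
      1 / 2 * ‖hF.toLp F‖ := by
  set I := ∫ z, hbound 0 z with hIdef
  have hI : 0 ≤ I := integral_nonneg (hbound_nonneg 0)
  -- Chosen so that `I / c ≤ 1 / 2`. The radius below gives `c² ≤ γmin * γ₀ y` for `|y| ≥ R`, by the
  -- cubic growth of `γ₀` and `|y| ≤ |y|³`.
  set c := 2 * I + 1 with hc
  have hc0 : 0 < c := by positivity
  have hm := γmin_pos
  set R := max 1 (6 * c ^ 2 / γmin) with hR
  refine ⟨R, fun F hF => ?_⟩
  set S := (Set.Icc (-R) R)ᶜ with hS
  have hSm : MeasurableSet S := measurableSet_Icc.compl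
  have hdom : KernelDominated (fun x y => S.indicator (fun y => Nker 0 x y) y)
      (fun z => hbound 0 z / c) :=
    { measurable := by
        have : Function.uncurry (fun x y => S.indicator (fun y => Nker 0 x y) y) =
            (Prod.snd ⁻¹' S).indicator (Function.uncurry (Nker 0)) := by
          ext p
          simp [Set.indicator, Function.uncurry]
        rw [this]
        exact (measurable_Nker 0).indicator (measurable_snd hSm)
      bound := fun x y => by
        by_cases hy : y ∈ S
        · rw [Set.indicator_of_mem hy]
          refine abs_Nker_le_of_le 0 hc0 ?_
          have hyR : R ≤ |y| := by
            by_contra hlt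
            exact hy (abs_le.mp (not_le.mp hlt).le)
          have h1 : 1 ≤ |y| := (le_max_left _ _).trans hyR
          have h2 : 6 * c ^ 2 / γmin ≤ |y| := (le_max_right _ _).trans hyR
          rw [div_le_iff₀ hm] at h2
          have h3 := cube_le_γ₀ y
          have h4 : |y| ≤ |y| ^ 3 := le_self_pow₀ h1 (by norm_num)
          nlinarith
        · rw [Set.indicator_of_notMem hy, abs_zero]
          exact div_nonneg (hbound_nonneg _ _) hc0.le
      integrable := (integrable_hbound 0).div_const _
      memLp := by
        simp only [div_eq_mul_inv]
        exact (memLp_hbound 0).mul_const _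
      even := fun z => by rw [hbound_neg] }
  have hop : Mop 0 ((hF.indicator hSm).toLp _) = hdom.opL (hF.toLp F) := by
    rw [Mop_toLp, hdom.opL_toLp hF]
    congr 1
    ext x
    simp only [intOp]
    congr 1; ext y
    by_cases hy : y ∈ S <;> simp [hy]
  rw [hop]
  refine (hdom.norm_opL_le _).trans (mul_le_mul_of_nonneg_right ?_ (norm_nonneg _))
  rw [integral_div, div_le_iff₀ hc0]
  linarith

/-- The spectral gap of `Mop 0`. -/
lemma exists_spectral_gap : ∃ q : ℝ, 0 ≤ q ∧ q < 1 ∧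
    ∀ F : Lp ℝ 2 (volume : Measure ℝ), ⟪eL, F⟫ = 0 → ‖Mop 0 F‖ ≤ q * ‖F‖ := by
  obtain ⟨R, htail⟩ := exists_tail_bound
  obtain ⟨c, hc, hloc⟩ := exists_local_poincare R
  -- From `‖P‖² ≤ D / c` and `‖M₀ F'‖² ≤ 2 ‖P‖² + ‖F'‖² / 2` one gets `‖F'‖² ≤ 2 D + 4 D / c = K D`.
  set K := 2 + 4 / c with hK
  have hK1 : 1 < K := by
    have : 0 < 4 / c := by positivity
    linarith
  have hq : 0 ≤ 1 - 1 / K := by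
    rw [sub_nonneg, div_le_one (by linarith)]; exact hK1.le
  refine ⟨√(1 - 1 / K), Real.sqrt_nonneg _, ?_, fun F hF => ?_⟩
  · rw [Real.sqrt_lt' one_pos]
    have : 0 < 1 / K := by positivity
    linarith
  obtain ⟨m, hm⟩ := hloc F (Lp.memLp F)
  rw [← norm_sq_eq, ← norm_Mop_zero_sq] at hm
  set D := ‖F‖ ^ 2 - ‖Mop 0 F‖ ^ 2 with hD
  -- Subtracting `m e` leaves the deficit unchanged, since `F` and `M₀ F` are both orthogonal to the
  -- fixed vector `e`, and it can only increase the norm.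
  set F' := F - m • eL with hF'
  have hnF : ‖F'‖ ^ 2 = ‖F‖ ^ 2 + m ^ 2 * ‖eL‖ ^ 2 := by
    rw [hF', norm_sub_sq_real, real_inner_smul_right, real_inner_comm, hF, norm_smul, mul_pow,
      Real.norm_eq_abs, sq_abs]
    ring
  have hMF' : Mop 0 F' = Mop 0 F - m • eL := by
    rw [hF', map_sub, map_smul, Mop_zero_eL]
  have horth : ⟪Mop 0 F, eL⟫ = 0 := by
    rw [inner_Mop, Mop_zero_eL, real_inner_comm, hF, mul_zero]
  have hnM : ‖Mop 0 F'‖ ^ 2 = ‖Mop 0 F‖ ^ 2 + m ^ 2 * ‖eL‖ ^ 2 := by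
    rw [hMF', norm_sub_sq_real, real_inner_smul_right, horth, norm_smul, mul_pow,
      Real.norm_eq_abs, sq_abs]
    ring
  have hB := measurableSet_Icc (a := -R) (b := R)
  set P := ((Lp.memLp F').indicator hB).toLp _
  set Q := ((Lp.memLp F').indicator hB.compl).toLp _
  have hPQ : F' = P + Q := by
    have h1 : P + Q = ((((Lp.memLp F').indicator hB).add
        ((Lp.memLp F').indicator hB.compl))).toLp _ := rfl
    rw [h1]
    simp only [Set.indicator_self_add_compl]
    exact (Lp.toLp_coeFn _ _).symm
  have hP : c * ‖P‖ ^ 2 ≤ D := by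
    refine le_trans (le_of_eq ?_) hm
    congr 1
    rw [norm_toLp_sq, ← integral_indicator hB]
    refine integral_congr_ae ?_
    filter_upwards [Lp.coeFn_sub F (m • eL), Lp.coeFn_smul m eL, memLp_evec.coeFn_toLp]
      with x h1 h2 h3
    have h4 : F' x = F x - m * evec x := by
      rw [hF', h1, Pi.sub_apply, h2, Pi.smul_apply, smul_eq_mul]
      congr 2
    by_cases hx : x ∈ Set.Icc (-R) R
    · rw [Set.indicator_of_mem hx, Set.indicator_of_mem hx, h4]
    · rw [Set.indicator_of_notMem hx, Set.indicator_of_notMem hx]; norm_num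
  have hQ : ‖Mop 0 Q‖ ≤ 1 / 2 * ‖F'‖ := by
    have := htail F' (Lp.memLp F')
    rwa [Lp.toLp_coeFn] at this
  have hsum : ‖Mop 0 F'‖ ≤ ‖P‖ + 1 / 2 * ‖F'‖ := by
    nth_rewrite 1 [hPQ]
    rw [map_add]
    exact (norm_add_le _ _).trans (add_le_add (norm_Mop_zero_le P) hQ)
  have hsq : ‖Mop 0 F'‖ ^ 2 ≤ 2 * ‖P‖ ^ 2 + 1 / 2 * ‖F'‖ ^ 2 := by
    have := pow_le_pow_left₀ (norm_nonneg _) hsum 2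
    nlinarith [sq_nonneg (‖P‖ - 1 / 2 * ‖F'‖)]
  have hP' : ‖P‖ ^ 2 ≤ D / c := by rw [le_div_iff₀ hc]; linarith
  have hfin : ‖F‖ ^ 2 ≤ K * D := by
    have h1 : D = ‖F'‖ ^ 2 - ‖Mop 0 F'‖ ^ 2 := by rw [hnF, hnM, hD]; ring
    have h2 : K * D = 2 * D + 4 * (D / c) := by rw [hK]; ring
    have h3 : 0 ≤ m ^ 2 * ‖eL‖ ^ 2 := by positivity
    rw [h2]; linarith
  refine abs_le_of_sq_le_sq' ?_ (by positivity) |>.2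
  rw [mul_pow, Real.sq_sqrt hq]
  have h1 : ‖F‖ ^ 2 / K ≤ D := by
    rw [div_le_iff₀ (by linarith)]; linarith
  have h2 : (1 - 1 / K) * ‖F‖ ^ 2 = ‖F‖ ^ 2 - ‖F‖ ^ 2 / K := by ring
  rw [h2]; linarith

/-- The operators of the integral equation form a gapped triple. -/
lemma exists_gappedTriple : ∃ q : ℝ, ∀ a b : ℝ, 0 < b →
    GappedTriple (Mop 0) (a • Mop 1) (b • Mop 2) eL q := by
  obtain ⟨q, h0, h1, hgap⟩ := exists_spectral_gap
  refine ⟨q, fun a b hb => ?_⟩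
  exact
    { symm₀ := fun x y => by rw [inner_Mop]; simp
      skew₁ := fun x y => by
        simp only [_root_.smul_apply, real_inner_smul_left, real_inner_smul_right]
        rw [inner_Mop]; ring
      symm₂ := fun x y => by
        simp only [_root_.smul_apply, real_inner_smul_left, real_inner_smul_right]
        rw [inner_Mop]; ring
      fix := Mop_zero_eL
      ne_zero := eL_ne_zero
      nonneg := h0
      lt_one := h1
      gap := hgap
      pos := by
        simp only [_root_.smul_apply, real_inner_smul_right]
        exact mul_pos hb inner_eL_Mop_two_pos }

end Bloch

end

/-! ### Scaling in `T` and the rate in terms of the symmetrized operators -/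

noncomputable section

namespace Bloch

variable {ω₀ εF T : ℝ}

/-- The factor `^ 0` is kept so that all three kernels share one form and the integrals are treated
uniformly in the exponent. -/
lemma Kbar₀_eq (ε u : ℝ) :
    Kbar₀ ω₀ T ε u = (T / ω₀) ^ 2 * ((u / T - ε / T) ^ 0 * kbar₀ (ε / T) (u / T - ε / T)) := by
  rw [Kbar₀, sub_div]; ring

lemma Kbar₁_eq (hω₀ : 0 < ω₀) (ε u : ℝ) :
    Kbar₁ ω₀ εF T ε u = 1 / (2 * εF) * T * (T / ω₀) ^ 2 *
      ((u / T - ε / T) ^ 1 * kbar₀ (ε / T) (u / T - ε / T)) := by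
  rw [Kbar₁, Kbar₀, sub_div]; field_simp

lemma Kbar₂_eq (ε u : ℝ) :
    Kbar₂ ω₀ T ε u = 1 / (2 * ω₀ ^ 2) * T ^ 2 * (T / ω₀) ^ 2 *
      ((u / T - ε / T) ^ 2 * kbar₀ (ε / T) (u / T - ε / T)) := by
  rw [Kbar₂, Kbar₀, sub_div]; field_simp

lemma integrable_scaled (hT : 0 < T) {g : ℝ → ℝ} (hg : Integrable g) (c : ℝ) :
    Integrable (fun u => c * g (u / T)) := (hg.comp_div hT.ne').const_mul c

lemma integral_scaled (hT : 0 < T) (g : ℝ → ℝ) (c : ℝ) :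
    ∫ u, c * g (u / T) = c * T * ∫ y, g y := by
  rw [integral_const_mul, Measure.integral_comp_div, abs_of_pos hT, smul_eq_mul]; ring

lemma integral_pow_mul_kbar₀ (i : ℕ) (x : ℝ) :
    ∫ y, (y - x) ^ i * kbar₀ x (y - x) = intOp (Nker i) evec x * γ₀ x / evec x := by
  have h1 := evec_pos x
  have h2 := γ₀_pos x
  rw [intOp_Nker_evec]; field_simp

lemma integrable_Kbar₀ (hT : 0 < T) (ε : ℝ) : Integrable (Kbar₀ ω₀ T ε) :=
  (integrable_scaled hT (integrable_pow_mul_kbar₀ 0 (ε / T)) _).congr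
    (Eventually.of_forall fun u => (Kbar₀_eq ε u).symm)

lemma integrable_Kbar₁ (hω₀ : 0 < ω₀) (hT : 0 < T) (ε : ℝ) : Integrable (Kbar₁ ω₀ εF T ε) :=
  (integrable_scaled hT (integrable_pow_mul_kbar₀ 1 (ε / T)) _).congr
    (Eventually.of_forall fun u => (Kbar₁_eq hω₀ ε u).symm)

lemma integrable_Kbar₂ (hT : 0 < T) (ε : ℝ) : Integrable (Kbar₂ ω₀ T ε) :=
  (integrable_scaled hT (integrable_pow_mul_kbar₀ 2 (ε / T)) _).congr
    (Eventually.of_forall fun u => (Kbar₂_eq ε u).symm)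

lemma Γ₀_eq (hT : 0 < T) (ε : ℝ) : Γ₀ ω₀ T ε = T ^ 3 / ω₀ ^ 2 * γ₀ (ε / T) := by
  simp only [Γ₀, Kbar₀_eq]
  rw [integral_scaled hT (fun y => (y - ε / T) ^ 0 * kbar₀ (ε / T) (y - ε / T)),
    integral_pow_mul_kbar₀, intOp_Nker_zero_evec]
  have := evec_pos (ε / T)
  field_simp

lemma Γ₁_eq (hω₀ : 0 < ω₀) (hT : 0 < T) (ε : ℝ) :
    Γ₁ ω₀ εF T ε = 1 / (2 * εF) * (T ^ 4 / ω₀ ^ 2) *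
      (intOp (Nker 1) evec (ε / T) * γ₀ (ε / T) / evec (ε / T)) := by
  simp only [Γ₁, Kbar₁_eq hω₀]
  rw [integral_scaled hT (fun y => (y - ε / T) ^ 1 * kbar₀ (ε / T) (y - ε / T)),
    integral_pow_mul_kbar₀]
  ring

lemma Γ₂_eq (hT : 0 < T) (ε : ℝ) :
    Γ₂ ω₀ T ε = 1 / (2 * ω₀ ^ 2) * (T ^ 5 / ω₀ ^ 2) *
      (intOp (Nker 2) evec (ε / T) * γ₀ (ε / T) / evec (ε / T)) := by
  simp only [Γ₂, Kbar₂_eq]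
  rw [integral_scaled hT (fun y => (y - ε / T) ^ 2 * kbar₀ (ε / T) (y - ε / T)),
    integral_pow_mul_kbar₀]
  ring

lemma Γ₀_pos (hω₀ : 0 < ω₀) (hT : 0 < T) (ε : ℝ) : 0 < Γ₀ ω₀ T ε := by
  rw [Γ₀_eq hT]
  have := γ₀_pos (ε / T)
  positivity

lemma pow_mul_kbar₀_eq (i : ℕ) (x y : ℝ) :
    (y - x) ^ i * kbar₀ x (y - x) = Nker i x y * evec y * γ₀ x / evec x := by
  have h1 := evec_pos x
  have h2 := γ₀_pos x
  rw [Nker_mul_evec]; field_simp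

lemma K₀_eq (hω₀ : 0 < ω₀) (hT : 0 < T) (ε u : ℝ) :
    K₀ ω₀ T ε u = 1 / (T * evec (ε / T)) * (Nker 0 (ε / T) (u / T) * evec (u / T)) := by
  have h1 := evec_pos (ε / T)
  have h2 := γ₀_pos (ε / T)
  rw [K₀, Γ₀_eq hT, Kbar₀_eq, pow_mul_kbar₀_eq]
  field_simp

/-- The combined symmetrized kernel at temperature `T`. -/
def Ncomb (ω₀ εF T x y : ℝ) : ℝ :=
  Nker 0 x y + T * (1 / (2 * εF)) * Nker 1 x y - T ^ 2 * (1 / (2 * ω₀ ^ 2)) * Nker 2 x y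

lemma K_eq (hω₀ : 0 < ω₀) (hT : 0 < T) (ε u : ℝ) :
    K ω₀ εF T ε u = 1 / (T * evec (ε / T)) * (Ncomb ω₀ εF T (ε / T) (u / T) * evec (u / T)) := by
  have h1 := evec_pos (ε / T)
  have h2 := γ₀_pos (ε / T)
  have e1 : K₁ ω₀ εF T ε u = 1 / (T * evec (ε / T)) *
      (T * (1 / (2 * εF)) * Nker 1 (ε / T) (u / T) * evec (u / T)) := by
    rw [K₁, Γ₀_eq hT, Kbar₁_eq hω₀, pow_mul_kbar₀_eq]
    field_simp
  have e2 : K₂ ω₀ T ε u = 1 / (T * evec (ε / T)) *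
      (T ^ 2 * (1 / (2 * ω₀ ^ 2)) * Nker 2 (ε / T) (u / T) * evec (u / T)) := by
    rw [K₂, Γ₀_eq hT, Kbar₂_eq, pow_mul_kbar₀_eq]
    field_simp
  rw [K, K₀_eq hω₀ hT, e1, e2, Ncomb]
  ring

lemma w_eq_evec (T ε : ℝ) : w T ε = evec (ε / T) ^ 2 / γ₀ (ε / T) := by
  have := γ₀_pos (ε / T)
  rw [w_eq, evec_sq]; field_simp

lemma w_eq_mul (T ε : ℝ) : w T ε = evec (ε / T) * bvec (ε / T) := by
  rw [w_eq, evec_mul_bvec]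

lemma integral_w (hT : 0 < T) : ∫ ε, w T ε = T := by
  have h : ∀ ε, w T ε = 1 * (fun x => 1 / (4 * ch x ^ 2)) (ε / T) := fun ε => by
    rw [w_eq, one_mul]
  simp only [h]
  rw [integral_scaled hT (fun x => 1 / (4 * ch x ^ 2)), integral_weight]; ring

/-- Image of `(K₀)^m (Γ₁/Γ₀)` in the symmetrized picture. -/
def Gseq (m : ℕ) : ℝ → ℝ := (intOp (Nker 0))^[m] (intOp (Nker 1) evec)

lemma Gseq_succ (m : ℕ) : Gseq (m + 1) = intOp (Nker 0) (Gseq m) := by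
  rw [Gseq, Function.iterate_succ_apply', Gseq]

lemma memLp_Gseq (m : ℕ) : MemLp (Gseq m) 2 volume := by
  induction m with
  | zero => exact (kernelDominated 1).memLp_intOp memLp_evec
  | succ k ih => rw [Gseq_succ]; exact (kernelDominated 0).memLp_intOp ih

lemma toLp_Gseq (m : ℕ) : (memLp_Gseq m).toLp (Gseq m) = ((Mop 0)^[m]) (Mop 1 eL) := by
  induction m with
  | zero => rw [eL, Mop_toLp]; rfl
  | succ k ih =>
    rw [Function.iterate_succ_apply', ← ih, Mop_toLp]
    congr 1
    exact Gseq_succ k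

/-- Conjugation by `evec` and dilation by `T` intertwine `K₀` with `intOp (Nker 0)`, so the
temperature enters only as one prefactor, the same for every `m`. -/
lemma iter_eq (hω₀ : 0 < ω₀) (hT : 0 < T) (m : ℕ) (ε : ℝ) :
    iter ω₀ εF T m ε = 1 / (2 * εF) * T * (Gseq m (ε / T) / evec (ε / T)) := by
  induction m generalizing ε with
  | zero =>
    have h1 := evec_pos (ε / T)
    have h2 := γ₀_pos (ε / T)
    simp only [iter, Gseq, Function.iterate_zero, id]
    rw [Γ₁_eq hω₀ hT, Γ₀_eq hT]
    field_simp
  | succ k ih =>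
    have h : iter ω₀ εF T (k + 1) = K₀op ω₀ T (iter ω₀ εF T k) := by
      rw [iter, Function.iterate_succ_apply', iter]
    have h1 := evec_pos (ε / T)
    have hpt : ∀ u, K₀ ω₀ T ε u * iter ω₀ εF T k u =
        1 / (2 * εF) / evec (ε / T) * (fun y => Nker 0 (ε / T) y * Gseq k y) (u / T) := by
      intro u
      have h2 := evec_pos (u / T)
      rw [ih, K₀_eq hω₀ hT]
      field_simp
    rw [h, K₀op]
    simp only [hpt]
    rw [integral_scaled hT (fun y => Nker 0 (ε / T) y * Gseq k y), Gseq_succ]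
    change _ * intOp (Nker 0) (Gseq k) (ε / T) = _
    ring

lemma integrable_K₀_mul_iter (hω₀ : 0 < ω₀) (hT : 0 < T) (m : ℕ) (ε : ℝ) :
    Integrable (fun u => K₀ ω₀ T ε u * iter ω₀ εF T m u) := by
  refine (integrable_scaled hT ((kernelDominated 0).integrable_section (memLp_Gseq m) (ε / T))
    (1 / (2 * εF) / evec (ε / T))).congr (Eventually.of_forall fun u => ?_)
  have h1 := evec_pos (ε / T)
  have h2 := evec_pos (u / T)
  simp only
  rw [iter_eq hω₀ hT, K₀_eq hω₀ hT]
  field_simp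

lemma Γ₂_mul_w (hT : 0 < T) (ε : ℝ) : Γ₂ ω₀ T ε * w T ε =
    1 / (2 * ω₀ ^ 2) * (T ^ 5 / ω₀ ^ 2) *
      (fun x => evec x * intOp (Nker 2) evec x) (ε / T) := by
  have h1 := evec_pos (ε / T)
  have h2 := γ₀_pos (ε / T)
  rw [Γ₂_eq hT, w_eq_evec]
  field_simp

lemma term_mul_w (hω₀ : 0 < ω₀) (hT : 0 < T) (m : ℕ) (ε : ℝ) : term ω₀ εF T m ε * w T ε =
    (1 / (2 * εF)) ^ 2 * (T ^ 5 / ω₀ ^ 2) *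
      (fun x => intOp (Nker 1) evec x * Gseq m x) (ε / T) := by
  have h1 := evec_pos (ε / T)
  have h2 := γ₀_pos (ε / T)
  rw [term, Γ₁_eq hω₀ hT, iter_eq hω₀ hT, w_eq_evec]
  field_simp

lemma integrable_Γ₂_mul_w (hT : 0 < T) : Integrable (fun ε => Γ₂ ω₀ T ε * w T ε) := by
  simp only [Γ₂_mul_w hT]
  exact integrable_scaled hT
    (memLp_evec.integrable_mul ((kernelDominated 2).memLp_intOp memLp_evec)) _

lemma integrable_term_mul_w (hω₀ : 0 < ω₀) (hT : 0 < T) (m : ℕ) :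
    Integrable (fun ε => term ω₀ εF T m ε * w T ε) := by
  simp only [term_mul_w hω₀ hT]
  exact integrable_scaled hT
    (((kernelDominated 1).memLp_intOp memLp_evec).integrable_mul (memLp_Gseq m)) _

lemma avg_Γ₂ (hT : 0 < T) : avg T (Γ₂ ω₀ T) =
    T ^ 5 / ω₀ ^ 2 * ⟪eL, ((1 / (2 * ω₀ ^ 2)) • Mop 2) eL⟫ := by
  rw [avg, integral_w hT]
  simp only [Γ₂_mul_w hT]
  rw [integral_scaled hT (fun x => evec x * intOp (Nker 2) evec x), ← inner_eL_Mop_eL,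
    _root_.smul_apply, real_inner_smul_right]
  field_simp

lemma avg_term (hω₀ : 0 < ω₀) (hT : 0 < T) (m : ℕ) : avg T (term ω₀ εF T m) =
    T ^ 5 / ω₀ ^ 2 * ⟪((1 / (2 * εF)) • Mop 1) eL,
      ((Mop 0)^[m]) (((1 / (2 * εF)) • Mop 1) eL)⟫ := by
  have hsm : ∀ (c : ℝ) (x : Lp ℝ 2 (volume : Measure ℝ)),
      ((Mop 0)^[m]) (c • x) = c • ((Mop 0)^[m]) x := by
    intro c x
    induction m with
    | zero => rfl
    | succ k ih => rw [Function.iterate_succ_apply', ih, map_smul, Function.iterate_succ_apply']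
  have hin : ⟪Mop 1 eL, ((Mop 0)^[m]) (Mop 1 eL)⟫ =
      ∫ x, intOp (Nker 1) evec x * Gseq m x := by
    rw [← toLp_Gseq, eL, Mop_toLp, inner_toLp_toLp]
  rw [avg, integral_w hT]
  simp only [term_mul_w hω₀ hT]
  rw [integral_scaled hT (fun x => intOp (Nker 1) evec x * Gseq m x), ← hin,
    _root_.smul_apply, hsm, real_inner_smul_right, real_inner_smul_left]
  field_simp

end Bloch

end

/-! ### The Boltzmann equation as an operator equation -/

noncomputable section

namespace Bloch

variable {ω₀ εF T : ℝ} {φ : ℝ → ℝ}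

lemma quasiMeasurePreserving_mul_left {c : ℝ} (hc : c ≠ 0) :
    Measure.QuasiMeasurePreserving (fun x : ℝ => c * x) volume volume := by
  refine ⟨by fun_prop, ?_⟩
  rw [Real.map_volume_mul_left hc]
  exact Measure.smul_absolutelyContinuous

lemma quasiMeasurePreserving_div {c : ℝ} (hc : c ≠ 0) :
    Measure.QuasiMeasurePreserving (fun x : ℝ => x / c) volume volume := by
  simp only [div_eq_inv_mul]
  exact quasiMeasurePreserving_mul_left (inv_ne_zero hc)

/-- A function of energy, transformed to dimensionless energy and symmetrized. -/
def scaled (ω₀ T : ℝ) (φ : ℝ → ℝ) : ℝ → ℝ := fun x => T ^ 3 / ω₀ ^ 2 * (evec x * φ (T * x))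

lemma scaled_div (hT : 0 < T) (φ : ℝ → ℝ) (ε : ℝ) :
    scaled ω₀ T φ (ε / T) = T ^ 3 / ω₀ ^ 2 * (evec (ε / T) * φ ε) := by
  rw [scaled, mul_div_cancel₀ _ hT.ne']

/-- Inverse of `scaled`. -/
def unscaled (ω₀ T : ℝ) (F : ℝ → ℝ) : ℝ → ℝ :=
  fun ε => F (ε / T) / (T ^ 3 / ω₀ ^ 2 * evec (ε / T))

lemma unscaled_scaled (hω₀ : 0 < ω₀) (hT : 0 < T) (φ : ℝ → ℝ) :
    unscaled ω₀ T (scaled ω₀ T φ) = φ := by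
  ext ε
  have := evec_pos (ε / T)
  rw [unscaled, scaled_div hT]
  field_simp

lemma scaled_unscaled (hω₀ : 0 < ω₀) (hT : 0 < T) (F : ℝ → ℝ) :
    scaled ω₀ T (unscaled ω₀ T F) = F := by
  ext x
  have := evec_pos x
  rw [scaled, unscaled, mul_div_cancel_left₀ _ hT.ne']
  field_simp

lemma aestronglyMeasurable_scaled_iff (hω₀ : 0 < ω₀) (hT : 0 < T) :
    AEStronglyMeasurable (scaled ω₀ T φ) volume ↔ AEStronglyMeasurable φ volume := by
  have he := measurable_evec
  constructor
  · intro h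
    rw [← unscaled_scaled hω₀ hT φ]
    have h1 := (h.comp_quasiMeasurePreserving (quasiMeasurePreserving_div hT.ne')).aemeasurable
    have h2 : Measurable (fun ε => T ^ 3 / ω₀ ^ 2 * evec (ε / T)) := by fun_prop
    exact (h1.div h2.aemeasurable).aestronglyMeasurable
  · intro h
    have h1 := h.comp_quasiMeasurePreserving (quasiMeasurePreserving_mul_left hT.ne')
    exact (he.aestronglyMeasurable.mul h1).const_mul _

/-- The density of `σ` is `T³ / ω₀² * evec (ε / T)²`, so `scaled` is an isometry up to a constant.
As the density is positive everywhere, measurability for `σ` and for Lebesgue measure agree. -/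
lemma memLp_sigma_iff (hω₀ : 0 < ω₀) (hT : 0 < T) :
    MemLp φ 2 (sigmaMeasure ω₀ T) ↔ MemLp (scaled ω₀ T φ) 2 volume := by
  have he := measurable_evec
  set d : ℝ → ℝ := fun ε => T ^ 3 / ω₀ ^ 2 * evec (ε / T) ^ 2 with hd
  have hdm : Measurable d := by fun_prop
  have hdpos : ∀ ε, 0 < d ε := fun ε => by
    have := evec_pos (ε / T)
    positivity
  have hwd : ∀ ε, w T ε * Γ₀ ω₀ T ε = d ε := fun ε => by
    have := γ₀_pos (ε / T)
    rw [w_eq_evec, Γ₀_eq hT]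
    simp only [hd]
    field_simp
  have hσ : sigmaMeasure ω₀ T = volume.withDensity fun ε => ((d ε).toNNReal : ENNReal) := by
    simp only [sigmaMeasure, hwd]
    rfl
  have hmeas : AEStronglyMeasurable φ (sigmaMeasure ω₀ T) ↔ AEStronglyMeasurable φ volume := by
    rw [hσ, aestronglyMeasurable_withDensity_iff hdm.real_toNNReal]
    simp only [fun ε => Real.coe_toNNReal _ (hdpos ε).le, smul_eq_mul]
    constructor
    · intro h
      refine (h.aemeasurable.div hdm.aemeasurable).aestronglyMeasurable.congr
        (Eventually.of_forall fun ε => ?_)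
      exact mul_div_cancel_left₀ _ (hdpos ε).ne'
    · intro h
      exact hdm.aestronglyMeasurable.mul h
  have hInt : Integrable (fun ε => φ ε ^ 2) (sigmaMeasure ω₀ T) ↔
      Integrable (fun x => scaled ω₀ T φ x ^ 2) := by
    rw [hσ, integrable_withDensity_iff_integrable_smul hdm.real_toNNReal,
      ← integrable_comp_div_iff (fun x => scaled ω₀ T φ x ^ 2) hT.ne']
    have hpt : (fun ε => (d ε).toNNReal • φ ε ^ 2) =
        fun ε => (T ^ 3 / ω₀ ^ 2)⁻¹ * scaled ω₀ T φ (ε / T) ^ 2 := by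
      ext ε
      rw [NNReal.smul_def, Real.coe_toNNReal _ (hdpos ε).le, scaled_div hT, smul_eq_mul]
      simp only [hd]
      field_simp
    rw [hpt, integrable_const_mul_iff (IsUnit.mk0 _ (by positivity))]
  constructor
  · intro h
    have hm := hmeas.mp h.aestronglyMeasurable
    rw [memLp_two_iff_integrable_sq ((aestronglyMeasurable_scaled_iff hω₀ hT).mpr hm)]
    exact hInt.mp h.integrable_sq
  · intro h
    have hm := (aestronglyMeasurable_scaled_iff hω₀ hT).mp h.aestronglyMeasurable
    rw [memLp_two_iff_integrable_sq (hmeas.mpr hm)]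
    exact hInt.mpr h.integrable_sq

/-- The operator of the integral equation in the symmetrized picture. -/
def Lop (ω₀ εF T : ℝ) : Lp ℝ 2 (volume : Measure ℝ) →L[ℝ] Lp ℝ 2 (volume : Measure ℝ) :=
  perturbedOp (Mop 0) ((1 / (2 * εF)) • Mop 1) ((1 / (2 * ω₀ ^ 2)) • Mop 2) T

lemma integrable_Ncomb {F : ℝ → ℝ} (hF : MemLp F 2 volume) (x : ℝ) :
    Integrable (fun y => Ncomb ω₀ εF T x y * F y) ∧
    ∫ y, Ncomb ω₀ εF T x y * F y = intOp (Nker 0) F x +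
      T * (1 / (2 * εF)) * intOp (Nker 1) F x -
      T ^ 2 * (1 / (2 * ω₀ ^ 2)) * intOp (Nker 2) F x := by
  have h0 := (kernelDominated 0).integrable_section hF x
  have h1 := ((kernelDominated 1).integrable_section hF x).const_mul (T * (1 / (2 * εF)))
  have h2 := ((kernelDominated 2).integrable_section hF x).const_mul
    (T ^ 2 * (1 / (2 * ω₀ ^ 2)))
  have hpt : (fun y => Ncomb ω₀ εF T x y * F y) = fun y => Nker 0 x y * F y +
      T * (1 / (2 * εF)) * (Nker 1 x y * F y) -
      T ^ 2 * (1 / (2 * ω₀ ^ 2)) * (Nker 2 x y * F y) := by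
    ext y; rw [Ncomb]; ring
  have h01 : Integrable (fun y => Nker 0 x y * F y +
      T * (1 / (2 * εF)) * (Nker 1 x y * F y)) := h0.add h1
  rw [hpt]
  refine ⟨h01.sub h2, ?_⟩
  rw [integral_sub h01 h2, integral_add h0 h1, integral_const_mul, integral_const_mul]
  rfl

lemma Lop_toLp_eq_bL_iff {F : ℝ → ℝ} (hF : MemLp F 2 volume) :
    Lop ω₀ εF T (hF.toLp F) = bL ↔
      ∀ᵐ x, F x = bvec x + ∫ y, Ncomb ω₀ εF T x y * F y := by
  rw [Lop, perturbedOp_apply, _root_.smul_apply, _root_.smul_apply, Mop_toLp, Mop_toLp, Mop_toLp,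
    bL, smul_smul, smul_smul, ← MemLp.toLp_const_smul, ← MemLp.toLp_const_smul,
    ← MemLp.toLp_sub, ← MemLp.toLp_sub, ← MemLp.toLp_add, MemLp.toLp_eq_toLp_iff]
  refine eventually_congr (Eventually.of_forall fun x => ?_)
  simp only [Pi.add_apply, Pi.sub_apply, Pi.smul_apply, smul_eq_mul, (integrable_Ncomb hF x).2]
  constructor <;> intro h <;> linarith

lemma K_mul_eq (hω₀ : 0 < ω₀) (hT : 0 < T) (φ : ℝ → ℝ) (ε u : ℝ) :
    K ω₀ εF T ε u * φ u = 1 / (T * (T ^ 3 / ω₀ ^ 2 * evec (ε / T))) *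
      (fun y => Ncomb ω₀ εF T (ε / T) y * scaled ω₀ T φ y) (u / T) := by
  have h1 := evec_pos (ε / T)
  simp only
  rw [K_eq hω₀ hT, scaled_div hT]
  field_simp

/-- The integral equation in the symmetrized picture. -/
lemma isSolution_iff (hω₀ : 0 < ω₀) (hT : 0 < T) :
    IsSolution ω₀ εF T φ ↔
      ∃ hF : MemLp (scaled ω₀ T φ) 2 volume, Lop ω₀ εF T (hF.toLp _) = bL := by
  have key : MemLp (scaled ω₀ T φ) 2 volume →
      ((∀ᵐ ε, Integrable (fun u => K ω₀ εF T ε u * φ u) ∧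
        φ ε = 1 / Γ₀ ω₀ T ε + ∫ u, K ω₀ εF T ε u * φ u) ↔
      ∀ᵐ x, scaled ω₀ T φ x = bvec x + ∫ y, Ncomb ω₀ εF T x y * scaled ω₀ T φ y) := by
    intro hF
    set F := scaled ω₀ T φ with hFdef
    -- The two equations correspond point by point under `x = ε / T`; the integrability clause is
    -- automatic for square-integrable `F`. Dilations preserve null sets, which transfers the
    -- almost-everywhere statements.
    have hpt : ∀ ε, (Integrable (fun u => K ω₀ εF T ε u * φ u) ∧
        φ ε = 1 / Γ₀ ω₀ T ε + ∫ u, K ω₀ εF T ε u * φ u) ↔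
        F (ε / T) = bvec (ε / T) + ∫ y, Ncomb ω₀ εF T (ε / T) y * F y := by
      intro ε
      have h1 := evec_pos (ε / T)
      have h2 := γ₀_pos (ε / T)
      have h3 : bvec (ε / T) = evec (ε / T) / γ₀ (ε / T) := by
        have h4 := ch_pos (ε / T)
        have h5 := sγ_pos (ε / T)
        rw [← sγ_sq, bvec, evec]; field_simp
      simp only [K_mul_eq hω₀ hT φ ε]
      rw [integral_scaled hT (fun y => Ncomb ω₀ εF T (ε / T) y * scaled ω₀ T φ y),
        and_iff_right (integrable_scaled hT (integrable_Ncomb hF (ε / T)).1 _), Γ₀_eq hT, h3,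
        hFdef, scaled_div hT, ← hFdef]
      generalize (∫ y, Ncomb ω₀ εF T (ε / T) y * F y) = J
      generalize evec (ε / T) = e at *
      generalize γ₀ (ε / T) = g at *
      have hc : 0 < T ^ 3 / ω₀ ^ 2 := by positivity
      have h6 : 1 / (T * (T ^ 3 / ω₀ ^ 2 * e)) * T * J = J / (T ^ 3 / ω₀ ^ 2 * e) := by
        field_simp
      rw [h6]
      generalize T ^ 3 / ω₀ ^ 2 = c at *
      constructor
      · intro h
        rw [h]; field_simp
      · intro h
        have : φ ε = (c * (e * φ ε)) / (c * e) := by field_simp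
        rw [this, h]; field_simp
    constructor
    · intro h
      have := (quasiMeasurePreserving_mul_left hT.ne').ae h
      filter_upwards [this] with x hx
      have := (hpt (T * x)).mp hx
      rwa [mul_div_cancel_left₀ _ hT.ne'] at this
    · intro h
      have := (quasiMeasurePreserving_div hT.ne').ae h
      filter_upwards [this] with ε hε
      exact (hpt ε).mpr hε
  constructor
  · intro h
    have hF := (memLp_sigma_iff hω₀ hT).mp h.memLp
    exact ⟨hF, (Lop_toLp_eq_bL_iff hF).mpr ((key hF).mp h.eqn)⟩
  · rintro ⟨hF, h⟩
    exact ⟨(memLp_sigma_iff hω₀ hT).mpr hF, (key hF).mpr ((Lop_toLp_eq_bL_iff hF).mp h)⟩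

lemma w_mul_eq (hω₀ : 0 < ω₀) (hT : 0 < T) (φ : ℝ → ℝ) (ε : ℝ) :
    w T ε * φ ε = ω₀ ^ 2 / T ^ 3 * (fun x => bvec x * scaled ω₀ T φ x) (ε / T) := by
  simp only
  rw [w_eq_mul, scaled_div hT]
  field_simp

lemma integrable_w_mul (hω₀ : 0 < ω₀) (hT : 0 < T) (hF : MemLp (scaled ω₀ T φ) 2 volume) :
    Integrable (fun ε => w T ε * φ ε) := by
  simp only [w_mul_eq hω₀ hT φ]
  exact integrable_scaled hT (memLp_bvec.integrable_mul hF) _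

lemma relaxationTime_eq (hω₀ : 0 < ω₀) (hT : 0 < T) (hF : MemLp (scaled ω₀ T φ) 2 volume) :
    relaxationTime T φ = ω₀ ^ 2 / (2 * T ^ 3) * ⟪bL, hF.toLp _⟫ := by
  rw [relaxationTime]
  simp only [w_mul_eq hω₀ hT φ]
  rw [integral_scaled hT (fun x => bvec x * scaled ω₀ T φ x), bL, inner_toLp_toLp]
  field_simp

lemma ae_eq_of_scaled_ae_eq (hω₀ : 0 < ω₀) (hT : 0 < T) {ψ : ℝ → ℝ}
    (h : scaled ω₀ T ψ =ᵐ[volume] scaled ω₀ T φ) : ψ =ᵐ[volume] φ := by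
  filter_upwards [(quasiMeasurePreserving_div hT.ne').ae h] with ε hε
  rw [← unscaled_scaled hω₀ hT ψ, ← unscaled_scaled hω₀ hT φ, unscaled, unscaled, hε]

end Bloch

end

/-! ### Existence, uniqueness and Bloch's law -/

theorem theorem3p1 (ω₀ εF : ℝ) (hω₀ : 0 < ω₀) (hεF : 0 < εF) :
    -- all integrals and the series that define `φ₊` converge, and `1/φ₊` is positive
    (∀ T : ℝ, 0 < T →
      (∀ ε, Integrable (Bloch.Kbar₀ ω₀ T ε) ∧ Integrable (Bloch.Kbar₁ ω₀ εF T ε) ∧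
        Integrable (Bloch.Kbar₂ ω₀ T ε) ∧ 0 < Bloch.Γ₀ ω₀ T ε) ∧
      (∀ (m : ℕ) (ε : ℝ),
        Integrable (fun u => Bloch.K₀ ω₀ T ε u * Bloch.iter ω₀ εF T m u)) ∧
      Integrable (fun ε => Bloch.Γ₂ ω₀ T ε * Bloch.w T ε) ∧
      (∀ m : ℕ, Integrable (fun ε => Bloch.term ω₀ εF T m ε * Bloch.w T ε)) ∧
      Summable (fun m : ℕ => Bloch.avg T (Bloch.term ω₀ εF T m)) ∧
      0 < Bloch.rate ω₀ εF T) ∧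
    -- at low temperature the integral equation has exactly one solution,
    -- and its energy average converges
    (∃ T₀ : ℝ, 0 < T₀ ∧ ∀ T : ℝ, 0 < T → T < T₀ →
      ∃ φ : ℝ → ℝ, Bloch.IsSolution ω₀ εF T φ ∧
        Integrable (fun ε => Bloch.w T ε * φ ε) ∧
        ∀ ψ : ℝ → ℝ, Bloch.IsSolution ω₀ εF T ψ → ψ =ᵐ[volume] φ) ∧
    -- leading behaviour of the relaxation time and Bloch's law
    (∃ C : ℝ, 0 < C ∧ (∀ T : ℝ, 0 < T → Bloch.phiPlus ω₀ εF T = C / T ^ 5) ∧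
      ∀ φ : ℝ → ℝ → ℝ, (∀ᶠ T in 𝓝[>] (0 : ℝ), Bloch.IsSolution ω₀ εF T (φ T)) →
        ((fun T => Bloch.relaxationTime T (φ T)) ~[𝓝[>] (0 : ℝ)]
          (fun T => Bloch.phiPlus ω₀ εF T / 2)) ∧
        Tendsto (fun T => T ^ 5 * Bloch.relaxationTime T (φ T)) (𝓝[>] (0 : ℝ))
          (𝓝 (C / 2))) := by
  open Bloch in
  obtain ⟨q, hq⟩ := exists_gappedTriple
  have hG := hq (1 / (2 * εF)) (1 / (2 * ω₀ ^ 2)) (by positivity)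
  -- Skewness makes `M₁ e` orthogonal to `e`, so the Neumann series applies. The same `v` sums the
  -- series in `rate` and serves as corrector in the asymptotics, which is why the two constants
  -- coincide.
  obtain ⟨v, hv, hsum, hv0⟩ := hG.exists_neumann hG.inner_skew_fixed
  set κ := ⟪eL, ((1 / (2 * ω₀ ^ 2)) • Mop 2) eL⟫ + ⟪((1 / (2 * εF)) • Mop 1) eL, v⟫ with hκ
  have hκ0 : 0 < κ := add_pos_of_pos_of_nonneg hG.pos hv0
  have hseries : ∀ T : ℝ, 0 < T → HasSum (fun m : ℕ => avg T (Bloch.term ω₀ εF T m))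
      (T ^ 5 / ω₀ ^ 2 * ⟪((1 / (2 * εF)) • Mop 1) eL, v⟫) := fun T hT => by
    simp only [avg_term hω₀ hT]
    exact hsum.mul_left _
  have hrate : ∀ T : ℝ, 0 < T → rate ω₀ εF T = T ^ 5 / ω₀ ^ 2 * κ := fun T hT => by
    rw [rate, (hseries T hT).tsum_eq, avg_Γ₂ hT, hκ, mul_add]
  have hphi : ∀ T : ℝ, 0 < T → phiPlus ω₀ εF T = ω₀ ^ 2 / κ / T ^ 5 := fun T hT => by
    rw [phiPlus, hrate T hT]; field_simp
  refine ⟨fun T hT => ⟨fun ε => ⟨integrable_Kbar₀ hT ε, integrable_Kbar₁ hω₀ hT ε,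
    integrable_Kbar₂ hT ε, Γ₀_pos hω₀ hT ε⟩, fun m ε => integrable_K₀_mul_iter hω₀ hT m ε,
    integrable_Γ₂_mul_w hT, fun m => integrable_term_mul_w hω₀ hT m, (hseries T hT).summable,
    ?_⟩, ?_, ω₀ ^ 2 / κ, by positivity, hphi, fun φ hφ => ?_⟩
  · rw [hrate T hT]; positivity
  · obtain ⟨T₀, hT₀, hbij⟩ := hG.exists_unique_solution
    refine ⟨T₀, hT₀, fun T hT hTT => ?_⟩
    obtain ⟨F, hF⟩ := (hbij T hT hTT).2 bL
    have hs := scaled_unscaled hω₀ hT F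
    have hmem : MemLp (scaled ω₀ T (unscaled ω₀ T F)) 2 volume := by
      rw [hs]; exact Lp.memLp F
    have htoLp : hmem.toLp _ = F := by
      simp only [hs]; exact Lp.toLp_coeFn _ _
    refine ⟨unscaled ω₀ T F, (isSolution_iff hω₀ hT).mpr ⟨hmem, by rw [htoLp]; exact hF⟩,
      integrable_w_mul hω₀ hT hmem, fun ψ hψ => ?_⟩
    obtain ⟨hψm, hψe⟩ := (isSolution_iff hω₀ hT).mp hψ
    have heq : hψm.toLp _ = hmem.toLp _ := by
      rw [htoLp]; exact (hbij T hT hTT).1 (hψe.trans hF.symm)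
    exact ae_eq_of_scaled_ae_eq hω₀ hT ((MemLp.toLp_eq_toLp_iff _ _).mp heq)
  · classical
    -- The default `0` is harmless: it is taken only where `φ T` is not square integrable, and this
    -- does not occur for small `T`.
    set F : ℝ → Lp ℝ 2 (volume : Measure ℝ) := fun T =>
      if h : MemLp (scaled ω₀ T (φ T)) 2 volume then h.toLp _ else 0 with hFdef
    have hsol : ∀ᶠ T in 𝓝[>] (0 : ℝ), 0 < T ∧ Lop ω₀ εF T (F T) = bL ∧
        relaxationTime T (φ T) = ω₀ ^ 2 / (2 * T ^ 3) * ⟪bL, F T⟫ := by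
      filter_upwards [hφ, self_mem_nhdsWithin] with T hT hpos
      have hpos : 0 < T := hpos
      obtain ⟨hm, he⟩ := (isSolution_iff hω₀ hpos).mp hT
      have hFT : F T = hm.toLp _ := dif_pos hm
      rw [hFT]
      exact ⟨hpos, he, relaxationTime_eq hω₀ hpos hm⟩
    have hlim := hG.tendsto_sq_mul_inner hv inner_eL_bL hκ0 (hsol.mono fun T h => h.2.1)
    have hbloch : Tendsto (fun T => T ^ 5 * relaxationTime T (φ T)) (𝓝[>] (0 : ℝ))
        (𝓝 (ω₀ ^ 2 / κ / 2)) := by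
      have h1 := hlim.const_mul (ω₀ ^ 2 / 2)
      rw [show ω₀ ^ 2 / 2 * (1 / κ) = ω₀ ^ 2 / κ / 2 by ring] at h1
      refine h1.congr' ?_
      filter_upwards [hsol] with T hT
      have := hT.1
      rw [hT.2.2]
      field_simp
    refine ⟨?_, hbloch⟩
    have hne : ∀ᶠ T in 𝓝[>] (0 : ℝ), phiPlus ω₀ εF T / 2 ≠ 0 := by
      filter_upwards [self_mem_nhdsWithin] with T hT
      have hT : 0 < T := hT
      rw [hphi T hT]
      positivity
    rw [isEquivalent_iff_tendsto_one hne]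
    have h1 := hbloch.div_const (ω₀ ^ 2 / κ / 2)
    rw [div_self (by positivity)] at h1
    refine h1.congr' ?_
    filter_upwards [self_mem_nhdsWithin] with T hT
    have hT : 0 < T := hT
    rw [Pi.div_apply, hphi T hT]
    field_simp
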